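/- Let $\mathfrak X$ be a set of candidates (a measurable space, finite or infinite), $f\sim GP(0,k)$ a centered Gaussian process on $\mathfrak X$ with $k(x,x')\le 1$ for all $x,x'$ and $k(x,x)>0$ for all $x$, and let $\epsilon_1,\epsilon_2,\dots$ be i.i.d. $\mathcal N(0,\sigma^2)$ with $\sigma>0$, independent of $f$. Assume that $(x,\omega)\mapsto f(x)(\omega)$ is measurable with respect to the product of the $\sigma$-algebra of $\mathfrak X$ and the $\sigma$-algebra generated by the values of $f$, and that $\max_{x\in\mathfrak X}f(x)$ (read as a supremum) is a.s. finite and integrable; for finite $\mathfrak X$ with all subsets measurable this is automatic. In round $t$ a point $x_t$, a measurable function of the data $\mathfrak D_{t-1}=((x_\tau,y_\tau))_{\tau<t}$, is chosen and $y_t=f(x_t)+\epsilon_t$ is observed. With the kernel matrix $K_{t}=[k(x_i,x_j)]_{i,j\le t}$ and $\mathbf k_t(x)=[k(x_i,x)]_{i\le t}$, the posterior mean and variance are $$\mu_t(x)=\mathbf k_t(x)^{\top}(K_t+\sigma^2I)^{-1}\mathbf y_t,\qquad \sigma_t^2(x)=k(x,x)-\mathbf k_t(x)^{\top}(K_t+\sigma^2I)^{-1}\mathbf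 k_t(x).$$ Let $\hat m_t$, a function of $\mathfrak D_{t-1}$, be the estimate of $\max f$ in round $t$. EST chooses $x_t$ as a minimizer of $x\mapsto(\hat m_t-\mu_{t-1}(x))/\sigma_{t-1}(x)$, or, for finite $\mathfrak X$, as a maximizer of $x\mapsto Q\big(\tfrac{\hat m_t-\mu_{t-1}(x)}{\sigma_{t-1}(x)}\big)\prod_{x'\ne x}\Phi\big(\tfrac{\hat m_t-\mu_{t-1}(x')}{\sigma_{t-1}(x')}\big)$, where $\Phi$ is the standard normal distribution function and $Q=1-\Phi$. Let $\tilde r_t=\max_{x}f(x)-f(x_t)$ be the regret of round $t$, and, for $T\ge 1$, $$\nu_t=\min_{x\in\mathfrak X}\frac{\hat m_t-\mu_{t-1}(x)}{\sigma_{t-1}(x)},\quad \nu_{t^*}=\max_{1\le t\le T}\nu_t,\quad C=\frac{2}{\log(1+\sigma^{-2})},\quad \gamma_T=\sup_{a\in\mathfrak X^T}\tfrac12\log\det\big(I+\sigma^{-2}[k(a_i,a_j)]_{i,j\le T}\big),$$ the last being the maximum information gain from $T$ measurements (points may be measured repeatedly). (i) Almost surely, if $\hat m_t\ge\mathbb E[\max_x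 f(x)\mid\mathfrak D_{t-1}]$ for all $1\le t\le T$, then $$\sum_{t=1}^T\mathbb E[\tilde r_t\mid\mathfrak D_{t-1}]\le\nu_{t^*}\sqrt{C\,T\,\gamma_T}.$$ (ii) For every $\delta\in(0,1)$, with $\zeta_T=(2\log\tfrac{T}{2\delta})^{1/2}$ (read as $0$ if $T<2\delta$), the following holds outside an event of probability at most $\delta$: if $\hat m_t\ge\max_x f(x)$ for all $1\le t\le T$, then $$\sum_{t=1}^T\tilde r_t\le(\nu_{t^*}+\zeta_T)\sqrt{C\,T\,\gamma_T}.$$ In particular, if $\hat m_t\ge\max_x f(x)$ almost surely for all $1\le t\le T$ (and $\hat m_t$ is measurable), then the bound in (i) holds almost surely, and the bound in (ii) holds with probability at least $1-\delta$. -/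

import Mathlib

open MeasureTheory ProbabilityTheory

namespace GPOpt

noncomputable section

variable {X Ω : Type*}

/-- The kernel matrix of a finite sequence of points (repetitions are allowed). -/
def kernelMatrix (k : X → X → ℝ) {n : ℕ} (a : Fin n → X) : Matrix (Fin n) (Fin n) ℝ :=
  Matrix.of fun i j => k (a i) (a j)

/-- The vector of covariances between the points of a finite sequence and a further point. -/
def kernelVec (k : X → X → ℝ) {n : ℕ} (a : Fin n → X) (x : X) : Fin n → ℝ :=
  fun i => k (a i) x

/-- The Gaussian process posterior mean at `x`, given the data `D` (pairs of a query point and a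
noisy observation) and noise variance `σ ^ 2`. -/
def postMean (k : X → X → ℝ) (σ : ℝ) {n : ℕ} (D : Fin n → X × ℝ) (x : X) : ℝ :=
  kernelVec k (fun i => (D i).1) x ⬝ᵥ
    Matrix.mulVec (kernelMatrix k (fun i => (D i).1) + σ ^ 2 • (1 : Matrix (Fin n) (Fin n) ℝ))⁻¹
      (fun i => (D i).2)

/-- The Gaussian process posterior covariance, given the data `D`. -/
def postCov (k : X → X → ℝ) (σ : ℝ) {n : ℕ} (D : Fin n → X × ℝ) (x x' : X) : ℝ :=
  k x x' - kernelVec k (fun i => (D i).1) x ⬝ᵥ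
    Matrix.mulVec (kernelMatrix k (fun i => (D i).1) + σ ^ 2 • (1 : Matrix (Fin n) (Fin n) ℝ))⁻¹
      (kernelVec k (fun i => (D i).1) x')

/-- The posterior standard deviation, given the data `D`. -/
def postSD (k : X → X → ℝ) (σ : ℝ) {n : ℕ} (D : Fin n → X × ℝ) (x : X) : ℝ :=
  Real.sqrt (postCov k σ D x x)

/-- The standardized gap between a target value `m` and the mean at `x`. -/
def gap (m : ℝ) (μ s : X → ℝ) (x : X) : ℝ := (m - μ x) / s x

/-- The cumulative distribution function of the standard normal distribution. -/
def stdPhi (z : ℝ) : ℝ := (gaussianReal 0 1).real (Set.Iic z)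

/-- The tail probability of the standard normal distribution. -/
def stdQ (z : ℝ) : ℝ := (gaussianReal 0 1).real (Set.Ioi z)

open Classical in
/-- The mean-field probability that `x` is a maximizer over a finite candidate set, when the maximum
value is `m` and the function values are treated as independent Gaussians with means `μ` and
standard deviations `s`. -/
def argmaxProb [Fintype X] (m : ℝ) (μ s : X → ℝ) (x : X) : ℝ :=
  stdQ (gap m μ s x) * ∏ x' ∈ Finset.univ.erase x, stdPhi (gap m μ s x')

/-- `x` is a point that the estimation strategy (EST) may choose when its estimate of the maximum
is `m`. Both forms of the rule are admitted: `x` minimizes the standardized gap (the algorithmic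
form, which makes sense for every candidate set), or the candidate set is finite and `x` maximizes
the mean-field probability of being a maximizer. -/
def IsESTChoice (m : ℝ) (μ s : X → ℝ) (x : X) : Prop :=
  (∀ x', gap m μ s x ≤ gap m μ s x') ∨
    ∃ _ : Fintype X, ∀ x', argmaxProb m μ s x' ≤ argmaxProb m μ s x

/-- The data collected in the first `n` rounds, when the query point of the round that follows `n`
observations is `sel n` of the data so far, and the observation is the value of `f` there plus
noise. -/
def data (sel : (n : ℕ) → (Fin n → X × ℝ) → X) (f : X → Ω → ℝ) (ε : ℕ → Ω → ℝ) :
    (n : ℕ) → Ω → Fin n → X × ℝ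
  | 0, _ => Fin.elim0
  | n + 1, ω =>
    Fin.snoc (α := fun _ => X × ℝ) (data sel f ε n ω)
      (sel n (data sel f ε n ω), f (sel n (data sel f ε n ω)) ω + ε n ω)

/-- The point queried in the round that follows `n` observations. -/
def query (sel : (n : ℕ) → (Fin n → X × ℝ) → X) (f : X → Ω → ℝ) (ε : ℕ → Ω → ℝ)
    (n : ℕ) (ω : Ω) : X :=
  sel n (data sel f ε n ω)

/-- The maximum (supremum) of the unknown function. -/
def fmax (f : X → Ω → ℝ) (ω : Ω) : ℝ := ⨆ x, f x ω

/-- The regret of the round that follows `n` observations. -/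
def regret (sel : (n : ℕ) → (Fin n → X × ℝ) → X) (f : X → Ω → ℝ) (ε : ℕ → Ω → ℝ)
    (n : ℕ) (ω : Ω) : ℝ :=
  fmax f ω - f (query sel f ε n ω) ω

/-- The sigma-algebra generated by the data of the first `n` rounds. -/
abbrev dataSigma [MeasurableSpace X] (sel : (n : ℕ) → (Fin n → X × ℝ) → X) (f : X → Ω → ℝ)
    (ε : ℕ → Ω → ℝ) (n : ℕ) : MeasurableSpace Ω :=
  MeasurableSpace.comap (data sel f ε n) MeasurableSpace.pi

/-- The sigma-algebra generated by the values of the random function `f`. -/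
abbrev funSigma (f : X → Ω → ℝ) : MeasurableSpace Ω :=
  MeasurableSpace.comap (fun ω x => f x ω) MeasurableSpace.pi

/-- The smallest standardized gap between the estimate `mhat n` of the maximum and the posterior
mean, in the round that follows `n` observations. -/
def nu (k : X → X → ℝ) (σ : ℝ) (mhat : (n : ℕ) → (Fin n → X × ℝ) → ℝ) (n : ℕ)
    (D : Fin n → X × ℝ) : ℝ :=
  ⨅ x, gap (mhat n D) (postMean k σ D) (postSD k σ D) x

/-- The largest of the gaps `nu` over the first `T` rounds, on the trajectory `ω`. -/
def nuStar (k : X → X → ℝ) (σ : ℝ) (mhat : (n : ℕ) → (Fin n → X × ℝ) → ℝ)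
    (sel : (n : ℕ) → (Fin n → X × ℝ) → X) (f : X → Ω → ℝ) (ε : ℕ → Ω → ℝ) (T : ℕ) (ω : Ω) : ℝ :=
  ⨆ n : Fin T, nu k σ mhat n (data sel f ε n ω)

/-- The information gained about the process from one noisy measurement at each entry of `a`. -/
def infoGain (k : X → X → ℝ) (σ : ℝ) {T : ℕ} (a : Fin T → X) : ℝ :=
  1 / 2 * Real.log
    ((1 : Matrix (Fin T) (Fin T) ℝ) + (σ ^ 2)⁻¹ • kernelMatrix k a).det

/-- The maximum information gain from `T` measurements. -/
def maxInfoGain (k : X → X → ℝ) (σ : ℝ) (T : ℕ) : ℝ := ⨆ a : Fin T → X, infoGain k σ a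

/-- The constant of the regret bounds. -/
def constC (σ : ℝ) : ℝ := 2 / Real.log (1 + (σ ^ 2)⁻¹)

/-- The confidence width of the high-probability bound. -/
def zeta (T : ℕ) (δ : ℝ) : ℝ := Real.sqrt (2 * Real.log (T / (2 * δ)))

/-- `f` is a Gaussian process with mean zero and covariance function `k`. -/
structure IsCenteredGP [MeasurableSpace Ω] (f : X → Ω → ℝ) (k : X → X → ℝ) (P : Measure Ω) :
    Prop where
  gaussian : IsGaussianProcess f P
  mean_zero : ∀ x, ∫ ω, f x ω ∂P = 0
  cov_eq : ∀ x x', cov[f x, f x'; P] = k x x'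

/-- `ε` is a sequence of independent Gaussian noise variables with mean zero and variance
`σ ^ 2`. -/
structure IsGaussianNoise [MeasurableSpace Ω] (ε : ℕ → Ω → ℝ) (σ : ℝ) (P : Measure Ω) :
    Prop where
  measurable : ∀ n, Measurable (ε n)
  law : ∀ n, P.map (ε n) = gaussianReal 0 (Real.toNNReal (σ ^ 2))
  indep : iIndepFun ε P

end

end GPOpt

/-!
Write `D` for the data before a round, `x` for the query point of that round, a function of `D`,
and `μ`, `s` for the posterior mean and standard deviation given `D`. The probabilistic core is
`map_data_innovation`: the standardized error `(f x - μ x) / s x` is standard Gaussian and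
independent of `D`, although the query points were chosen adaptively.

The reason is that the way in which the points are chosen cancels from Bayes' formula. The joint
law of the data and of `f` has a density with respect to the product of a reference measure on
data, which depends on the selection rule only, and of the law of `f`; the density is the product
of the Gaussian densities of the observations (`lintegral_data_eq`). So it suffices to know, for
each single value `D` of the data, the law of `f x` weighted by the likelihood of `D`; there the
query points are constants. For constant query points, `f x` minus its best linear prediction from
the observations is jointly Gaussian with the observations and uncorrelated with them, hence
independent of them, with variance the posterior variance. This gives Bayes' formula for almost
every vector of observations, and continuity in the observations gives it for every one
(`lintegral_boundedContinuous_mul_likelihood`). The null sets have to be removed at this point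
because the points themselves depend on the observations.

The rest is elementary. Either form of the strategy minimizes the standardized gap
(`IsESTChoice.gap_le`), so `m - μ x = ν s x` for the estimate `m` of the maximum. Hence, where `m`
is an upper bound, the regret of a round is at most `ν s x` in conditional expectation, as `μ x` is
the conditional expectation of `f x`, and at most `(ν + ζ) s x` outside an event of probability `δ / T`, by the Gaussian tail
bound. Summing over the rounds, the Cauchy-Schwarz inequality leaves the sum of the posterior
variances `s x ^ 2`, which is at most `C` times the information gained (`sum_postSD_sq_le`): by
Schur complements the log-determinant is a sum of terms `log (1 + σ⁻² s x ^ 2)`, and the logarithm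
is concave.
-/

namespace GPOpt

open Matrix Filter
open scoped ENNReal NNReal Topology

/-! ### Linear algebra of the posterior variance and the information gain -/

section LinearAlgebra

variable {X : Type*} {k : X → X → ℝ} {σ : ℝ} {n : ℕ}

/-- A symmetric positive semidefinite kernel: every finite quadratic form built from it is
nonnegative. -/
structure IsPSDKernel (k : X → X → ℝ) : Prop where
  symm : ∀ x y, k x y = k y x
  nonneg : ∀ (n : ℕ) (a : Fin n → X) (c : Fin n → ℝ), 0 ≤ ∑ i, ∑ j, c i * c j * k (a i) (a j)

/-- The regularized kernel matrix `K + σ² I`, which is the covariance matrix of the observations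
at the points of `a`. -/
noncomputable def obsMatrix (k : X → X → ℝ) (σ : ℝ) (a : Fin n → X) : Matrix (Fin n) (Fin n) ℝ :=
  kernelMatrix k a + σ ^ 2 • (1 : Matrix (Fin n) (Fin n) ℝ)

/-- The regression coefficients `(K + σ² I)⁻¹ k(x)`: the weights of the observations in the
posterior mean at `x`. -/
noncomputable def coeffs (k : X → X → ℝ) (σ : ℝ) (a : Fin n → X) (x : X) : Fin n → ℝ :=
  (obsMatrix k σ a)⁻¹ *ᵥ kernelVec k a x

lemma dotProduct_kernelMatrix_mulVec (a : Fin n → X) (c : Fin n → ℝ) :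
    c ⬝ᵥ (kernelMatrix k a *ᵥ c) = ∑ i, ∑ j, c i * c j * k (a i) (a j) := by
  simp only [dotProduct, mulVec, kernelMatrix, of_apply, Finset.mul_sum]
  exact Finset.sum_congr rfl fun i _ => Finset.sum_congr rfl fun j _ => by ring

lemma dotProduct_obsMatrix_mulVec (a : Fin n → X) (c : Fin n → ℝ) :
    c ⬝ᵥ (obsMatrix k σ a *ᵥ c) = c ⬝ᵥ (kernelMatrix k a *ᵥ c) + σ ^ 2 * (c ⬝ᵥ c) := by
  simp [obsMatrix, add_mulVec, dotProduct_add, smul_mulVec]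

lemma IsPSDKernel.isHermitian_obsMatrix (hk : IsPSDKernel k) (a : Fin n → X) :
    (obsMatrix k σ a).IsHermitian := by
  ext i j
  simp [obsMatrix, kernelMatrix, hk.symm (a i) (a j), one_apply, eq_comm]

lemma IsPSDKernel.posDef_obsMatrix (hk : IsPSDKernel k) (hσ : 0 < σ) (a : Fin n → X) :
    (obsMatrix k σ a).PosDef := by
  refine PosDef.of_dotProduct_mulVec_pos (hk.isHermitian_obsMatrix a) fun c hc => ?_
  have h1 : 0 ≤ c ⬝ᵥ (kernelMatrix k a *ᵥ c) := by
    rw [dotProduct_kernelMatrix_mulVec]; exact hk.nonneg n a c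
  have h2 : 0 < c ⬝ᵥ c := by simpa using dotProduct_star_self_pos_iff.2 hc
  have h3 : 0 < σ ^ 2 * (c ⬝ᵥ c) := by positivity
  simpa [dotProduct_obsMatrix_mulVec] using add_pos_of_nonneg_of_pos h1 h3

lemma IsPSDKernel.isUnit_det_obsMatrix (hk : IsPSDKernel k) (hσ : 0 < σ) (a : Fin n → X) :
    IsUnit (obsMatrix k σ a).det :=
  (hk.posDef_obsMatrix hσ a).det_pos.ne'.isUnit

lemma IsPSDKernel.obsMatrix_mulVec_coeffs (hk : IsPSDKernel k) (hσ : 0 < σ) (a : Fin n → X)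
    (x : X) : obsMatrix k σ a *ᵥ coeffs k σ a x = kernelVec k a x := by
  rw [coeffs, mulVec_mulVec, mul_nonsing_inv _ (hk.isUnit_det_obsMatrix hσ a), one_mulVec]

lemma postCov_eq (D : Fin n → X × ℝ) (x : X) :
    postCov k σ D x x = k x x - kernelVec k (fun i => (D i).1) x ⬝ᵥ
      coeffs k σ (fun i => (D i).1) x := rfl

lemma IsPSDKernel.postMean_eq (hk : IsPSDKernel k) (D : Fin n → X × ℝ) (x : X) :
    postMean k σ D x = ∑ i, coeffs k σ (fun i => (D i).1) x i * (D i).2 := by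
  have hT : ((obsMatrix k σ fun i => (D i).1)⁻¹)ᵀ = (obsMatrix k σ fun i => (D i).1)⁻¹ := by
    rw [transpose_nonsing_inv]
    exact congrArg _ (hk.isHermitian_obsMatrix fun i => (D i).1)
  change _ ⬝ᵥ ((obsMatrix k σ fun i => (D i).1)⁻¹ *ᵥ _) = _
  rw [dotProduct_mulVec, ← mulVec_transpose, hT]
  rfl

/-- The posterior variance is the prior variance of `f x - ∑ cᵢ (f (a i) + εᵢ)`, with `c` the
regression coefficients. -/
lemma IsPSDKernel.postCov_eq_residual (hk : IsPSDKernel k) (hσ : 0 < σ) (D : Fin n → X × ℝ)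
    (x : X) {c : Fin n → ℝ} (hc : c = coeffs k σ (fun i => (D i).1) x) :
    postCov k σ D x x = k x x - 2 * ∑ i, c i * k (D i).1 x
      + ∑ i, ∑ j, c i * c j * k (D i).1 (D j).1 + σ ^ 2 * ∑ i, c i ^ 2 := by
  have h1 : c ⬝ᵥ (obsMatrix k σ (fun i => (D i).1) *ᵥ c) = ∑ i, c i * k (D i).1 x := by
    rw [hc, hk.obsMatrix_mulVec_coeffs hσ]; rfl
  have h2 := dotProduct_obsMatrix_mulVec (k := k) (σ := σ) (fun i => (D i).1) c
  rw [dotProduct_kernelMatrix_mulVec, h1] at h2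
  have h3 : c ⬝ᵥ c = ∑ i, c i ^ 2 := by simp [dotProduct, sq]
  have h4 : kernelVec k (fun i => (D i).1) x ⬝ᵥ c = ∑ i, c i * k (D i).1 x := by
    rw [dotProduct_comm]; rfl
  rw [postCov_eq, ← hc, h4, ← h3]
  linarith

lemma IsPSDKernel.residual_nonneg (hk : IsPSDKernel k) (a : Fin n → X) (x : X) (c : Fin n → ℝ) :
    0 ≤ k x x - 2 * ∑ i, c i * k (a i) x + ∑ i, ∑ j, c i * c j * k (a i) (a j) := by
  have h := hk.nonneg (n + 1) (Fin.snoc (α := fun _ => X) a x)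
    (Fin.snoc (α := fun _ => ℝ) (fun i => -c i) 1)
  simp only [Fin.sum_univ_castSucc, Fin.snoc_castSucc, Fin.snoc_last, Finset.sum_add_distrib] at h
  have h1 : ∀ i, k x (a i) = k (a i) x := fun i => hk.symm _ _
  simp only [h1, mul_one, one_mul, mul_neg, neg_mul, neg_neg, Finset.sum_neg_distrib] at h
  linarith

lemma IsPSDKernel.sq_coeffs_le (hk : IsPSDKernel k) (hσ : 0 < σ) (D : Fin n → X × ℝ) (x : X) :
    σ ^ 2 * ∑ i, coeffs k σ (fun i => (D i).1) x i ^ 2 ≤ postCov k σ D x x := by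
  rw [hk.postCov_eq_residual hσ D x rfl]
  linarith [hk.residual_nonneg (fun i => (D i).1) x (coeffs k σ (fun i => (D i).1) x)]

lemma IsPSDKernel.postCov_pos (hk : IsPSDKernel k) (hσ : 0 < σ) (D : Fin n → X × ℝ) {x : X}
    (hx : 0 < k x x) : 0 < postCov k σ D x x := by
  have h := hk.sq_coeffs_le hσ D x
  have h0 : 0 ≤ ∑ i, coeffs k σ (fun i => (D i).1) x i ^ 2 :=
    Finset.sum_nonneg fun i _ => sq_nonneg _
  rcases h0.eq_or_lt' with h0 | h0
  · have hc : coeffs k σ (fun i => (D i).1) x = 0 := by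
      ext i
      simpa using (Finset.sum_eq_zero_iff_of_nonneg fun i _ => sq_nonneg _).1 h0 i
    rw [postCov_eq, hc]
    simpa using hx
  · exact lt_of_lt_of_le (by positivity) h

lemma IsPSDKernel.postCov_le (hk : IsPSDKernel k) (hσ : 0 < σ) (D : Fin n → X × ℝ) (x : X) :
    postCov k σ D x x ≤ k x x := by
  have h : 0 ≤ kernelVec k (fun i => (D i).1) x ⬝ᵥ coeffs k σ (fun i => (D i).1) x := by
    rw [dotProduct_comm, ← hk.obsMatrix_mulVec_coeffs hσ]
    simpa using (hk.posDef_obsMatrix hσ _).posSemidef.dotProduct_mulVec_nonneg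
      (coeffs k σ (fun i => (D i).1) x)
  rw [postCov_eq]
  linarith

lemma IsPSDKernel.abs_coeffs_le (hk : IsPSDKernel k) (hσ : 0 < σ) (D : Fin n → X × ℝ) {x : X}
    (hx : k x x ≤ 1) (i : Fin n) : |coeffs k σ (fun i => (D i).1) x i| ≤ σ⁻¹ := by
  have h1 := hk.sq_coeffs_le hσ D x
  have h2 := hk.postCov_le hσ D x
  have h3 : coeffs k σ (fun i => (D i).1) x i ^ 2
      ≤ ∑ i, coeffs k σ (fun i => (D i).1) x i ^ 2 :=
    Finset.single_le_sum (f := fun i => coeffs k σ (fun i => (D i).1) x i ^ 2)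
      (fun i _ => sq_nonneg _) (Finset.mem_univ i)
  have h4 : (σ * coeffs k σ (fun i => (D i).1) x i) ^ 2 ≤ 1 ^ 2 := by
    have := mul_le_mul_of_nonneg_left h3 (sq_nonneg σ)
    rw [mul_pow]; linarith
  have h5 := abs_le_of_sq_le_sq h4 zero_le_one
  rw [abs_mul, abs_of_pos hσ] at h5
  rwa [← one_div, le_div_iff₀' hσ]

lemma IsPSDKernel.det_obsMatrix_succ (hk : IsPSDKernel k) (hσ : 0 < σ) (a : Fin (n + 1) → X)
    (D : Fin n → X × ℝ) (hD : ∀ i, (D i).1 = a i.castSucc) :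
    (obsMatrix k σ a).det = (obsMatrix k σ fun i : Fin n => a i.castSucc).det
      * (σ ^ 2 + postCov k σ D (a (Fin.last n)) (a (Fin.last n))) := by
  have hD' : (fun i => (D i).1) = fun i => a i.castSucc := funext hD
  set A := obsMatrix k σ fun i : Fin n => a i.castSucc with hA
  have hU : IsUnit A.det := hk.isUnit_det_obsMatrix hσ _
  let _ : Invertible A := A.invertibleOfIsUnitDet hU
  set x := a (Fin.last n)
  set v := kernelVec k (fun i : Fin n => a i.castSucc) x
  have hb : (obsMatrix k σ a).submatrix finSumFinEquiv finSumFinEquiv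
      = fromBlocks A (replicateCol (Fin 1) v) (replicateRow (Fin 1) v)
        (of fun _ _ => k x x + σ ^ 2) := by
    ext i j
    have hl : ∀ j : Fin n, Fin.castAdd 1 j ≠ Fin.last n := fun j => (Fin.castSucc_lt_last j).ne
    have hlast : Fin.natAdd n (0 : Fin 1) = Fin.last n := rfl
    rcases i with i | i <;> rcases j with j | j
    · simp [hA, obsMatrix, kernelMatrix, one_apply, Fin.castSucc]
    · rw [Subsingleton.elim j 0]
      simp [obsMatrix, kernelMatrix, one_apply, v, kernelVec, hl, hlast, x, Fin.castSucc]
    · rw [Subsingleton.elim i 0]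
      simp [obsMatrix, kernelMatrix, one_apply, v, kernelVec, (hl _).symm, hlast, x, Fin.castSucc,
        hk.symm (a (Fin.last n))]
    · rw [Subsingleton.elim i 0, Subsingleton.elim j 0]
      simp [obsMatrix, kernelMatrix, one_apply, hlast, x]
  rw [← det_submatrix_equiv_self finSumFinEquiv, hb, det_fromBlocks₁₁, det_fin_one]
  congr 1
  rw [postCov_eq, hD', coeffs, ← hA, invOf_eq_nonsing_inv, dotProduct_mulVec]
  simp only [Matrix.sub_apply, of_apply, mul_apply, replicateRow_apply, replicateCol_apply, vecMul,
    dotProduct]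
  ring

lemma infoGain_eq (hσ : 0 < σ) (a : Fin n → X) :
    infoGain k σ a = 1 / 2 * Real.log (((σ ^ 2)⁻¹) ^ n * (obsMatrix k σ a).det) := by
  have : (1 : Matrix (Fin n) (Fin n) ℝ) + (σ ^ 2)⁻¹ • kernelMatrix k a
      = (σ ^ 2)⁻¹ • obsMatrix k σ a := by
    rw [obsMatrix, smul_add, smul_smul, inv_mul_cancel₀ (by positivity), one_smul, add_comm]
  rw [infoGain, this, det_smul, Fintype.card_fin]

/-- The chain rule for the information gain. -/
lemma IsPSDKernel.infoGain_succ (hk : IsPSDKernel k) (hσ : 0 < σ) (hpos : ∀ x, 0 < k x x)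
    (a : Fin (n + 1) → X) (D : Fin n → X × ℝ) (hD : ∀ i, (D i).1 = a i.castSucc) :
    infoGain k σ a = infoGain k σ (fun i : Fin n => a i.castSucc) + 1 / 2 * Real.log
      (1 + (σ ^ 2)⁻¹ * postCov k σ D (a (Fin.last n)) (a (Fin.last n))) := by
  have h1 := (hk.posDef_obsMatrix hσ fun i : Fin n => a i.castSucc).det_pos
  have h2 := hk.postCov_pos hσ D (hpos (a (Fin.last n)))
  rw [infoGain_eq hσ, infoGain_eq hσ, hk.det_obsMatrix_succ hσ a D hD, ← mul_add,
    ← Real.log_mul (by positivity) (by positivity)]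
  congr 2
  rw [pow_succ]
  field_simp

/-- The information gain of a whole sequence of measurements, as a sum over the rounds. Only the
query points of the data matter, so the observations are set to zero. -/
lemma IsPSDKernel.infoGain_eq_sum (hk : IsPSDKernel k) (hσ : 0 < σ) (hpos : ∀ x, 0 < k x x)
    (b : ℕ → X) (T : ℕ) :
    infoGain k σ (fun i : Fin T => b i) = ∑ n ∈ Finset.range T, 1 / 2 * Real.log
      (1 + (σ ^ 2)⁻¹ * postCov k σ (fun i : Fin n => (b i, (0 : ℝ))) (b n) (b n)) := by
  induction T with
  | zero => simp [infoGain]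
  | succ T ih =>
    rw [Finset.sum_range_succ, ← ih, hk.infoGain_succ hσ hpos _
      (fun i : Fin T => (b i, (0 : ℝ))) fun i => rfl]
    rfl

lemma IsPSDKernel.bddAbove_infoGain (hk : IsPSDKernel k) (hσ : 0 < σ) (hpos : ∀ x, 0 < k x x)
    (hle : ∀ x, k x x ≤ 1) (T : ℕ) :
    BddAbove (Set.range fun a : Fin T → X => infoGain k σ a) := by
  refine ⟨∑ n ∈ Finset.range T, 1 / 2 * Real.log (1 + (σ ^ 2)⁻¹), ?_⟩
  rintro _ ⟨a, rfl⟩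
  rcases T with _ | T
  · simp [infoGain]
  · set b : ℕ → X := fun m => if h : m < T + 1 then a ⟨m, h⟩ else a 0
    have hab : a = fun i : Fin (T + 1) => b i := by
      ext i; simp [b, not_lt.2 (Nat.lt_succ_iff.1 i.isLt)]
    simp only
    rw [hab, hk.infoGain_eq_sum hσ hpos]
    refine Finset.sum_le_sum fun n _ => ?_
    have h1 := hk.postCov_pos hσ (fun i : Fin n => (b i, (0 : ℝ))) (hpos (b n))
    have h2 := (hk.postCov_le hσ (fun i : Fin n => (b i, (0 : ℝ))) (b n)).trans (hle _)
    gcongr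
    exact mul_le_of_le_one_right (by positivity) h2

lemma postCov_congr (D D' : Fin n → X × ℝ) (h : ∀ i, (D i).1 = (D' i).1) (x x' : X) :
    postCov k σ D x x' = postCov k σ D' x x' := by
  have : (fun i => (D i).1) = fun i => (D' i).1 := funext h
  simp only [postCov, this]

end LinearAlgebra

/-! ### Gaussian tails, the logarithm, and the choice of the query point -/

section Analytic

/-- By concavity of the logarithm, a variance in `[0, 1]` is at most a constant times the
information gained by measuring it in noise. -/
lemma le_constC_mul_log {σ s : ℝ} (hσ : 0 < σ) (h0 : 0 ≤ s) (h1 : s ≤ 1) :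
    s ≤ constC σ * (1 / 2 * Real.log (1 + (σ ^ 2)⁻¹ * s)) := by
  have ha : 0 < (σ ^ 2)⁻¹ := by positivity
  have hl : 0 < Real.log (1 + (σ ^ 2)⁻¹) := Real.log_pos (by linarith)
  have h := strictConcaveOn_log_Ioi.concaveOn.2 (x := 1) (y := 1 + (σ ^ 2)⁻¹)
    (Set.mem_Ioi.2 one_pos) (Set.mem_Ioi.2 (by linarith)) (sub_nonneg.2 h1) h0 (by ring)
  simp only [smul_eq_mul, Real.log_one, mul_zero, zero_add] at h
  have h' : (1 - s) * 1 + s * (1 + (σ ^ 2)⁻¹) = 1 + (σ ^ 2)⁻¹ * s := by ring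
  rw [h'] at h
  rw [constC, ← mul_assoc, div_mul_div_comm, mul_one, mul_comm _ (2 : ℝ),
    div_mul_cancel_left₀ two_ne_zero, inv_mul_eq_div, le_div_iff₀ hl]
  exact h

lemma constC_nonneg (σ : ℝ) : 0 ≤ constC σ :=
  div_nonneg zero_le_two (Real.log_nonneg (by have := sq_nonneg σ; simp [this]))

instance : (gaussianReal 0 1).IsOpenPosMeasure :=
  (gaussianReal_absolutelyContinuous' 0 one_ne_zero).isOpenPosMeasure

lemma stdPhi_strictMono : StrictMono stdPhi := by
  intro a b hab
  have h : Set.Iic b = Set.Iic a ∪ Set.Ioc a b := (Set.Iic_union_Ioc_eq_Iic hab.le).symm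
  have hd : Disjoint (Set.Iic a) (Set.Ioc a b) := Set.Iic_disjoint_Ioc le_rfl
  have hpos : 0 < (gaussianReal 0 1).real (Set.Ioc a b) := by
    refine ENNReal.toReal_pos (fun h0 => ?_) (measure_ne_top _ _)
    exact (isOpen_Ioo.measure_pos (gaussianReal 0 1) (Set.nonempty_Ioo.2 hab)).ne'
      (measure_mono_null Set.Ioo_subset_Ioc_self h0)
  rw [stdPhi, stdPhi, h, measureReal_union hd measurableSet_Ioc]
  linarith

lemma stdPhi_pos (z : ℝ) : 0 < stdPhi z :=
  lt_of_le_of_lt measureReal_nonneg (stdPhi_strictMono (sub_one_lt z))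

lemma stdQ_eq (z : ℝ) : stdQ z = 1 - stdPhi z := by
  rw [stdQ, ← Set.compl_Iic, probReal_compl_eq_one_sub measurableSet_Iic, stdPhi]

/-- Both forms of the strategy choose a minimizer of the standardized gap: the mean-field
probability of being the maximizer at `x` is a common factor times `Q / Φ` at the gap of `x`, and
`Q / Φ` is strictly decreasing. -/
lemma IsESTChoice.gap_le {X : Type*} {m : ℝ} {μ s : X → ℝ} {x : X} (h : IsESTChoice m μ s x)
    (x' : X) : gap m μ s x ≤ gap m μ s x' := by
  classical
  rcases h with h | ⟨hX, h⟩
  · exact h x'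
  rcases eq_or_ne x' x with rfl | hne
  · exact le_rfl
  have h := h x'
  set c := ∏ y ∈ (Finset.univ.erase x).erase x', stdPhi (gap m μ s y) with hc
  have hcpos : 0 < c := Finset.prod_pos fun _ _ => stdPhi_pos _
  have e1 : argmaxProb m μ s x = stdQ (gap m μ s x) * (stdPhi (gap m μ s x') * c) := by
    rw [argmaxProb, hc, Finset.mul_prod_erase _ (fun y => stdPhi (gap m μ s y)) (by simp [hne])]
  have e2 : argmaxProb m μ s x' = stdQ (gap m μ s x') * (stdPhi (gap m μ s x) * c) := by
    rw [argmaxProb, hc, Finset.erase_right_comm,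
      Finset.mul_prod_erase _ (fun y => stdPhi (gap m μ s y)) (by simp [hne.symm])]
  rw [e1, e2, stdQ_eq, stdQ_eq, ← mul_assoc, ← mul_assoc] at h
  have h := le_of_mul_le_mul_right h hcpos
  exact stdPhi_strictMono.le_iff_le.1 (by linarith)

lemma nu_eq {X : Type*} {k : X → X → ℝ} {σ : ℝ} {mhat : (n : ℕ) → (Fin n → X × ℝ) → ℝ} {n : ℕ}
    {D : Fin n → X × ℝ} {x : X}
    (h : IsESTChoice (mhat n D) (postMean k σ D) (postSD k σ D) x) :
    nu k σ mhat n D = (mhat n D - postMean k σ D x) / postSD k σ D x := by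
  have : Nonempty X := ⟨x⟩
  refine le_antisymm (ciInf_le
    ⟨gap (mhat n D) (postMean k σ D) (postSD k σ D) x, ?_⟩ x) (le_ciInf h.gap_le)
  rintro _ ⟨y, rfl⟩
  exact h.gap_le y

/-- The Gaussian tail bound with the constant `1 / 2`, from comparing the density at `z + u` with
`exp (-z ^ 2 / 2)` times the density at `u`, for `u > 0`. -/
lemma gaussianReal_Ioi_le {z : ℝ} (hz : 0 ≤ z) :
    (gaussianReal 0 1) (Set.Ioi z) ≤ ENNReal.ofReal (1 / 2 * Real.exp (-z ^ 2 / 2)) := by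
  have hhalf : (gaussianReal 0 1) (Set.Ioi 0) ≤ ENNReal.ofReal (1 / 2) := by
    have hmap : (gaussianReal 0 1).map (fun x => -x) = gaussianReal 0 1 := by
      rw [gaussianReal_map_neg, neg_zero]
    have h1 : (gaussianReal 0 1) (Set.Iio 0) = (gaussianReal 0 1) (Set.Ioi 0) := by
      conv_lhs => rw [← hmap]
      rw [Measure.map_apply measurable_neg measurableSet_Iio]
      congr 1; ext x; simp
    have h2 : (gaussianReal 0 1) (Set.Iio 0) + (gaussianReal 0 1) (Set.Ioi 0) ≤ 1 := by
      have hd : Disjoint (Set.Iio (0 : ℝ)) (Set.Ioi 0) :=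
        Set.disjoint_left.2 fun x (hx : x < 0) (hx' : 0 < x) => lt_asymm hx hx'
      rw [← measure_union hd measurableSet_Ioi]
      exact prob_le_one
    rw [h1, ← two_mul] at h2
    rw [one_div, ENNReal.ofReal_inv_of_pos two_pos, ENNReal.ofReal_ofNat]
    rwa [ENNReal.le_inv_iff_mul_le, mul_comm]
  have hshift : Set.Ioi z = (fun u : ℝ => u + z) '' Set.Ioi 0 := by simp
  have hle : (gaussianReal 0 1) (Set.Ioi z)
      ≤ ENNReal.ofReal (Real.exp (-z ^ 2 / 2)) * (gaussianReal 0 1) (Set.Ioi 0) := by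
    rw [gaussianReal_apply _ one_ne_zero, gaussianReal_apply _ one_ne_zero,
      ← lintegral_const_mul _ (measurable_gaussianPDF 0 1),
      ← (measurePreserving_add_right volume z).setLIntegral_comp_preimage measurableSet_Ioi
        (measurable_gaussianPDF 0 1)]
    have hpre : (fun u : ℝ => u + z) ⁻¹' Set.Ioi z = Set.Ioi 0 := by ext; simp
    rw [hpre]
    refine setLIntegral_mono' measurableSet_Ioi fun u hu => ?_
    rw [gaussianPDF, gaussianPDF, ← ENNReal.ofReal_mul (Real.exp_pos _).le]
    refine ENNReal.ofReal_le_ofReal ?_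
    simp only [gaussianPDFReal, NNReal.coe_one, mul_one, sub_zero]
    rw [mul_left_comm, ← Real.exp_add]
    gcongr
    have : 0 ≤ u * z := mul_nonneg (le_of_lt hu) hz
    nlinarith
  refine hle.trans ?_
  rw [mul_comm (1 / 2 : ℝ), ENNReal.ofReal_mul (Real.exp_pos _).le]
  gcongr

/-- The confidence width is chosen so that the union bound over the `T` rounds costs at most `δ`.
If `T < 2 δ` the width is `0` and each tail has probability at most `1 / 2`. -/
lemma gaussianReal_Iio_neg_zeta_le {T : ℕ} (hT : 1 ≤ T) {δ : ℝ} (hδ : 0 < δ) :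
    (gaussianReal 0 1) (Set.Iio (-zeta T δ)) ≤ ENNReal.ofReal (δ / T) := by
  have hT' : (0 : ℝ) < T := by exact_mod_cast hT
  have hmap : (gaussianReal 0 1).map (fun x => -x) = gaussianReal 0 1 := by
    rw [gaussianReal_map_neg, neg_zero]
  have h1 : (gaussianReal 0 1) (Set.Iio (-zeta T δ)) = (gaussianReal 0 1) (Set.Ioi (zeta T δ)) := by
    conv_lhs => rw [← hmap]
    rw [Measure.map_apply measurable_neg measurableSet_Iio]
    congr 1; ext x; simp
  rw [h1]
  refine (gaussianReal_Ioi_le (Real.sqrt_nonneg _)).trans (ENNReal.ofReal_le_ofReal ?_)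
  have h2 : 2 * Real.log (T / (2 * δ)) ≤ zeta T δ ^ 2 := by
    rw [zeta, Real.sq_sqrt']; exact le_max_left _ _
  have h3 : Real.exp (-zeta T δ ^ 2 / 2) ≤ Real.exp (-Real.log (T / (2 * δ))) :=
    Real.exp_le_exp.2 (by linarith)
  rw [Real.exp_neg, Real.exp_log (by positivity), inv_div] at h3
  calc 1 / 2 * Real.exp (-zeta T δ ^ 2 / 2) ≤ 1 / 2 * (2 * δ / T) := by gcongr
    _ = δ / T := by ring

end Analytic

/-! ### Noisy observations at fixed points -/

/-- Noisy observations of a centered Gaussian process: the process is jointly measurable with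
respect to its own sigma-algebra, its kernel is positive on the diagonal and bounded by one, and
the noise is independent of it. -/
structure IsNoisyGP {Ω X : Type*} [MeasurableSpace Ω] [MeasurableSpace X] (P : Measure Ω)
    (f : X → Ω → ℝ) (k : X → X → ℝ) (ε : ℕ → Ω → ℝ) (σ : ℝ) : Prop where
  kernel_pos : ∀ x, 0 < k x x
  kernel_le : ∀ x x', k x x' ≤ 1
  measurable : ∀ x, Measurable (f x)
  jointly_measurable : Measurable[MeasurableSpace.prod inferInstance (funSigma f)]
    (fun p : X × Ω => f p.1 p.2)
  gp : IsCenteredGP f k P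
  sigma_pos : 0 < σ
  noise : IsGaussianNoise ε σ P
  indep : IndepFun (fun ω x => f x ω) (fun ω n => ε n ω) P

namespace IsNoisyGP

variable {Ω X : Type*} [MeasurableSpace Ω] [MeasurableSpace X] {P : Measure Ω}
  {f : X → Ω → ℝ} {k : X → X → ℝ} {ε : ℕ → Ω → ℝ} {σ : ℝ} {n : ℕ}

lemma memLp_two (h : IsNoisyGP P f k ε σ) (x : X) : MemLp (f x) 2 P :=
  (h.gp.gaussian.hasGaussianLaw_eval x).memLp_two

lemma hasGaussianLaw_noise (h : IsNoisyGP P f k ε σ) (n : ℕ) : HasGaussianLaw (ε n) P where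
  isGaussian_map := by rw [h.noise.law n]; infer_instance

lemma memLp_two_noise (h : IsNoisyGP P f k ε σ) (n : ℕ) : MemLp (ε n) 2 P :=
  (h.hasGaussianLaw_noise n).memLp_two

lemma measurable_path (h : IsNoisyGP P f k ε σ) : Measurable fun ω x => f x ω :=
  measurable_pi_lambda _ h.measurable

lemma measurable_uncurry (h : IsNoisyGP P f k ε σ) :
    Measurable fun p : X × Ω => f p.1 p.2 :=
  h.jointly_measurable.mono (sup_le_sup le_rfl
    (MeasurableSpace.comap_mono h.measurable_path.comap_le)) le_rfl

lemma kernel_eq_integral (h : IsNoisyGP P f k ε σ) (x x' : X) :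
    k x x' = ∫ ω, f x ω * f x' ω ∂P := by
  rw [← h.gp.cov_eq x x', covariance]
  simp [h.gp.mean_zero]

/-- The observation in round `i` when the query points are fixed in advance. -/
def fixedObs (f : X → Ω → ℝ) (ε : ℕ → Ω → ℝ) (a : Fin n → X) (i : Fin n) (ω : Ω) : ℝ :=
  f (a i) ω + ε i ω

/-- The error of the best linear prediction of `f z` from the observations at the points `a`. -/
noncomputable def residual (k : X → X → ℝ) (σ : ℝ) (f : X → Ω → ℝ) (ε : ℕ → Ω → ℝ)
    (a : Fin n → X) (z : X) (ω : Ω) : ℝ :=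
  f z ω - ∑ i, coeffs k σ a z i * fixedObs f ε a i ω

lemma measurable_fixedObs (h : IsNoisyGP P f k ε σ) (a : Fin n → X) (i : Fin n) :
    Measurable (fixedObs f ε a i) :=
  (h.measurable (a i)).add (h.noise.measurable i)

lemma measurable_residual (h : IsNoisyGP P f k ε σ) (a : Fin n → X) (z : X) :
    Measurable (residual k σ f ε a z) :=
  (h.measurable z).sub (Finset.measurable_sum _ fun i _ =>
    (h.measurable_fixedObs a i).const_mul _)

lemma covariance_noise (h : IsNoisyGP P f k ε σ) (i j : ℕ) :
    cov[ε i, ε j; P] = if i = j then σ ^ 2 else 0 := by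
  split_ifs with hij
  · subst hij
    rw [covariance_self (h.noise.measurable i).aemeasurable,
      ← variance_id_map (h.noise.measurable i).aemeasurable, h.noise.law i,
      variance_id_gaussianReal, Real.coe_toNNReal _ (sq_nonneg σ)]
  · exact (h.noise.indep.indepFun hij).covariance_eq_zero (h.memLp_two_noise i)
      (h.memLp_two_noise j)

lemma covariance_process_noise (h : IsNoisyGP P f k ε σ) (x : X) (i : ℕ) :
    cov[f x, ε i; P] = 0 :=
  (h.indep.comp (measurable_pi_apply x) (measurable_pi_apply i)).covariance_eq_zero
    (h.memLp_two x) (h.memLp_two_noise i)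

lemma memLp_two_fixedObs (h : IsNoisyGP P f k ε σ) (a : Fin n → X) (i : Fin n) :
    MemLp (fixedObs f ε a i) 2 P :=
  (h.memLp_two (a i)).add (h.memLp_two_noise i)

lemma hasGaussianLaw_residual_fixedObs (h : IsNoisyGP P f k ε σ) (a : Fin n → X) (z : X) :
    HasGaussianLaw (fun ω => ((fun _ : Unit => residual k σ f ε a z ω),
      fun i => fixedObs f ε a i ω)) P := by
  set b : Fin (n + 1) → X := Fin.snoc (α := fun _ => X) a z
  have h1 : HasGaussianLaw (fun ω i => f (b i) ω) P := by
    have := (h.gp.gaussian.comp_right b).hasGaussianLaw Finset.univ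
    let L : ({x // x ∈ (Finset.univ : Finset (Fin (n + 1)))} → ℝ) →L[ℝ] (Fin (n + 1) → ℝ) :=
      ContinuousLinearMap.pi fun i => ContinuousLinearMap.proj ⟨i, Finset.mem_univ i⟩
    exact this.map_fun L
  have h2 : HasGaussianLaw (fun ω (i : Fin n) => ε i ω) P :=
    (h.noise.indep.precomp Fin.val_injective).hasGaussianLaw fun i => h.hasGaussianLaw_noise i
  have h3 : HasGaussianLaw (fun ω => ((fun i => f (b i) ω), fun i : Fin n => ε i ω)) P := by
    refine IndepFun.hasGaussianLaw h1 h2 ?_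
    exact h.indep.comp (φ := fun φ i => φ (b i)) (ψ := fun e (i : Fin n) => e i)
      (measurable_pi_lambda _ fun i => measurable_pi_apply _)
      (measurable_pi_lambda _ fun i => measurable_pi_apply _)
  let Lf : Fin (n + 1) → ((Fin (n + 1) → ℝ) × (Fin n → ℝ)) →L[ℝ] ℝ := fun i =>
    (ContinuousLinearMap.proj i).comp (ContinuousLinearMap.fst ℝ _ _)
  let Lo : Fin n → ((Fin (n + 1) → ℝ) × (Fin n → ℝ)) →L[ℝ] ℝ := fun i =>
    Lf i.castSucc + (ContinuousLinearMap.proj i).comp (ContinuousLinearMap.snd ℝ _ _)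
  let L : ((Fin (n + 1) → ℝ) × (Fin n → ℝ)) →L[ℝ] (Unit → ℝ) × (Fin n → ℝ) :=
    (ContinuousLinearMap.pi fun _ => Lf (Fin.last n) - ∑ i, coeffs k σ a z i • Lo i).prod
      (ContinuousLinearMap.pi Lo)
  convert! h3.map_fun L using 2 with ω
  ext i
  · simp [L, Lf, Lo, residual, fixedObs, b, mul_add]
  · simp [L, Lf, Lo, fixedObs, b]

variable [IsProbabilityMeasure P]

lemma measurable_kernel (h : IsNoisyGP P f k ε σ) : Measurable fun p : X × X => k p.1 p.2 := by
  simp_rw [h.kernel_eq_integral]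
  have h1 : Measurable fun q : (X × X) × Ω => f q.1.1 q.2 * f q.1.2 q.2 :=
    (h.measurable_uncurry.comp (measurable_fst.fst.prodMk measurable_snd)).mul
      (h.measurable_uncurry.comp (measurable_fst.snd.prodMk measurable_snd))
  exact h1.stronglyMeasurable.integral_prod_right'.measurable

lemma isPSDKernel (h : IsNoisyGP P f k ε σ) : IsPSDKernel k where
  symm x y := by rw [← h.gp.cov_eq, covariance_comm, h.gp.cov_eq]
  nonneg n a c := by
    have hm : ∀ i, MemLp (fun ω => c i * f (a i) ω) 2 P := fun i =>
      (h.memLp_two (a i)).const_mul (c i)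
    have h1 : cov[fun ω => ∑ i, c i * f (a i) ω, fun ω => ∑ i, c i * f (a i) ω; P]
        = ∑ i, ∑ j, c i * c j * k (a i) (a j) := by
      rw [covariance_fun_sum_fun_sum hm hm]
      refine Finset.sum_congr rfl fun i _ => Finset.sum_congr rfl fun j _ => ?_
      rw [covariance_const_mul_left, covariance_const_mul_right, h.gp.cov_eq, mul_assoc]
    rw [← h1, covariance_self (memLp_finsetSum _ fun i _ => hm i).aemeasurable]
    exact variance_nonneg _ _

lemma covariance_process_fixedObs (h : IsNoisyGP P f k ε σ) (a : Fin n → X) (z : X) (j : Fin n) :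
    cov[f z, fixedObs f ε a j; P] = k z (a j) := by
  change cov[f z, f (a j) + ε j; P] = _
  rw [covariance_add_right (h.memLp_two z) (h.memLp_two _) (h.memLp_two_noise _), h.gp.cov_eq,
    h.covariance_process_noise, add_zero]

lemma covariance_fixedObs (h : IsNoisyGP P f k ε σ) (a : Fin n → X) (i j : Fin n) :
    cov[fixedObs f ε a i, fixedObs f ε a j; P] = obsMatrix k σ a i j := by
  change cov[f (a i) + ε i, fixedObs f ε a j; P] = _
  rw [covariance_add_left (h.memLp_two _) (h.memLp_two_noise _) (h.memLp_two_fixedObs a j),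
    h.covariance_process_fixedObs]
  change _ + cov[ε i, f (a j) + ε j; P] = _
  rw [covariance_add_right (h.memLp_two_noise _) (h.memLp_two _) (h.memLp_two_noise _),
    covariance_comm, h.covariance_process_noise, zero_add, h.covariance_noise]
  simp [obsMatrix, kernelMatrix, one_apply, Fin.ext_iff]

lemma covariance_residual (h : IsNoisyGP P f k ε σ) (a : Fin n → X) (z : X) {Y : Ω → ℝ}
    (hY : MemLp Y 2 P) : cov[residual k σ f ε a z, Y; P]
      = cov[f z, Y; P] - ∑ i, coeffs k σ a z i * cov[fixedObs f ε a i, Y; P] := by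
  have hm : ∀ i, MemLp (fun ω => coeffs k σ a z i * fixedObs f ε a i ω) 2 P := fun i =>
    (h.memLp_two_fixedObs a i).const_mul _
  change cov[fun ω => f z ω - ∑ i, coeffs k σ a z i * fixedObs f ε a i ω, Y; P] = _
  rw [covariance_fun_sub_left (h.memLp_two z) (memLp_finsetSum _ fun i _ => hm i) hY,
    covariance_fun_sum_left hm hY]
  simp_rw [covariance_const_mul_left]

/-- The prediction error is uncorrelated with the observations (the normal equations). -/
lemma covariance_residual_fixedObs (h : IsNoisyGP P f k ε σ) (a : Fin n → X) (z : X)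
    (j : Fin n) : cov[residual k σ f ε a z, fixedObs f ε a j; P] = 0 := by
  rw [h.covariance_residual a z (h.memLp_two_fixedObs a j), h.covariance_process_fixedObs]
  simp_rw [h.covariance_fixedObs]
  have h1 := congrFun (h.isPSDKernel.obsMatrix_mulVec_coeffs h.sigma_pos a z) j
  have h2 : ∀ i, obsMatrix k σ a j i = obsMatrix k σ a i j := fun i => by
    rw [← h.covariance_fixedObs, ← h.covariance_fixedObs, covariance_comm]
  rw [mulVec, dotProduct] at h1
  simp_rw [h2] at h1
  rw [h.isPSDKernel.symm z, sub_eq_zero]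
  rw [kernelVec] at h1
  rw [← h1]
  exact Finset.sum_congr rfl fun i _ => mul_comm _ _

lemma variance_residual (h : IsNoisyGP P f k ε σ) (D : Fin n → X × ℝ) (z : X) :
    Var[residual k σ f ε (fun i => (D i).1) z; P] = postCov k σ D z z := by
  set a := fun i => (D i).1
  have hR : MemLp (residual k σ f ε a z) 2 P :=
    (h.memLp_two z).sub (memLp_finsetSum _ fun i _ => (h.memLp_two_fixedObs a i).const_mul _)
  rw [← covariance_self hR.aemeasurable, h.covariance_residual a z hR]
  simp_rw [covariance_comm (fixedObs f ε a _), h.covariance_residual_fixedObs, mul_zero,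
    Finset.sum_const_zero, sub_zero]
  rw [covariance_comm, h.covariance_residual a z (h.memLp_two z), h.gp.cov_eq, postCov_eq,
    dotProduct]
  congr 1
  refine Finset.sum_congr rfl fun i _ => ?_
  rw [covariance_comm, h.covariance_process_fixedObs, mul_comm, h.isPSDKernel.symm, kernelVec]

lemma indepFun_residual_fixedObs (h : IsNoisyGP P f k ε σ) (a : Fin n → X) (z : X) :
    IndepFun (residual k σ f ε a z) (fun ω i => fixedObs f ε a i ω) P := by
  have h1 := HasGaussianLaw.indepFun_of_covariance_eval
    (X := fun _ : Unit => residual k σ f ε a z) (Y := fixedObs f ε a)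
    (h.hasGaussianLaw_residual_fixedObs a z) fun _ j => h.covariance_residual_fixedObs a z j
  exact h1.comp (φ := fun r : Unit → ℝ => r ()) (ψ := id) (measurable_pi_apply ()) measurable_id

lemma map_residual (h : IsNoisyGP P f k ε σ) (D : Fin n → X × ℝ) (z : X) :
    P.map (residual k σ f ε (fun i => (D i).1) z)
      = gaussianReal 0 (postCov k σ D z z).toNNReal := by
  have h1 := (h.hasGaussianLaw_residual_fixedObs (fun i => (D i).1) z).fst.eval ()
  rw [h1.map_eq_gaussianReal, h.variance_residual]
  congr 1
  have hi : ∀ i, Integrable (fixedObs f ε (fun i => (D i).1) i) P := fun i =>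
    (h.memLp_two_fixedObs _ i).integrable one_le_two
  have hn : ∀ i : ℕ, ∫ ω, ε i ω ∂P = 0 := fun i => by
    have := integral_map (μ := P) (h.noise.measurable i).aemeasurable
      (f := fun x : ℝ => x) measurable_id.aestronglyMeasurable
    rw [← this, h.noise.law i, integral_id_gaussianReal]
  have h0 : ∀ i, ∫ ω, fixedObs f ε (fun i => (D i).1) i ω ∂P = 0 := fun i => by
    change ∫ ω, f (D i).1 ω + ε i ω ∂P = 0
    rw [integral_add ((h.memLp_two _).integrable one_le_two)
      ((h.memLp_two_noise i).integrable one_le_two), h.gp.mean_zero, hn, add_zero]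
  change ∫ ω, f z ω - ∑ i, coeffs k σ (fun i => (D i).1) z i
    * fixedObs f ε (fun i => (D i).1) i ω ∂P = 0
  rw [integral_sub ((h.memLp_two z).integrable one_le_two)
    (integrable_finsetSum _ fun i _ => (hi i).const_mul _), h.gp.mean_zero,
    integral_finsetSum _ fun i _ => (hi i).const_mul _]
  simp_rw [integral_const_mul, h0]
  simp

end IsNoisyGP

/-! ### The likelihood of adaptively collected data -/

section Independence

variable {Ω α β γ : Type*} [MeasurableSpace Ω] [MeasurableSpace α] [MeasurableSpace β]
  [MeasurableSpace γ] {P : Measure Ω} [IsProbabilityMeasure P]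

lemma indepFun_prodMk_left {F : Ω → α} {U : Ω → β} {V : Ω → γ} (hF : Measurable F)
    (hU : Measurable U) (hV : Measurable V) (h : IndepFun F (fun ω => (U ω, V ω)) P)
    (hUV : IndepFun U V P) : IndepFun (fun ω => (F ω, U ω)) V P := by
  have hFU : IndepFun F U P := h.comp measurable_id measurable_fst
  have e1 := (indepFun_iff_map_prod_eq_prod_map_map hF.aemeasurable
    (hU.prodMk hV).aemeasurable).1 h
  have e2 := (indepFun_iff_map_prod_eq_prod_map_map hF.aemeasurable hU.aemeasurable).1 hFU
  have e3 := (indepFun_iff_map_prod_eq_prod_map_map hU.aemeasurable hV.aemeasurable).1 hUV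
  have := Measure.isProbabilityMeasure_map (μ := P) hF.aemeasurable
  have := Measure.isProbabilityMeasure_map (μ := P) hU.aemeasurable
  have := Measure.isProbabilityMeasure_map (μ := P) hV.aemeasurable
  rw [indepFun_iff_map_prod_eq_prod_map_map (hF.prodMk hU).aemeasurable hV.aemeasurable, e2]
  refine (MeasurableEquiv.map_measurableEquiv_injective MeasurableEquiv.prodAssoc) ?_
  rw [Measure.prodAssoc_prod, ← e3, ← e1,
    Measure.map_map MeasurableEquiv.prodAssoc.measurable ((hF.prodMk hU).prodMk hV)]
  rfl

/-- Freezing: an expectation involving two independent variables is an iterated integral. -/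
lemma lintegral_indepFun {U : Ω → α} {V : Ω → β} (hU : Measurable U) (hV : Measurable V)
    (h : IndepFun U V P) {H : α × β → ℝ≥0∞} (hH : Measurable H) :
    ∫⁻ ω, H (U ω, V ω) ∂P = ∫⁻ ω, ∫⁻ v, H (U ω, v) ∂(P.map V) ∂P := by
  have := Measure.isProbabilityMeasure_map (μ := P) hV.aemeasurable
  rw [← lintegral_map hH (hU.prodMk hV),
    (indepFun_iff_map_prod_eq_prod_map_map hU.aemeasurable hV.aemeasurable).1 h,
    lintegral_prod _ hH.aemeasurable, lintegral_map hH.lintegral_prod_right' hU]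

end Independence

lemma gaussianPDF_le (m : ℝ) (v : ℝ≥0) (y : ℝ) :
    gaussianPDF m v y ≤ ENNReal.ofReal (√(2 * Real.pi * v))⁻¹ := by
  refine ENNReal.ofReal_le_ofReal (mul_le_of_le_one_right (by positivity) ?_)
  rw [Real.exp_le_one_iff]
  exact div_nonpos_of_nonpos_of_nonneg (neg_nonpos.2 (sq_nonneg _)) (by positivity)

lemma measurable_snoc {α β : Type*} [MeasurableSpace α] [MeasurableSpace β] {n : ℕ}
    {u : β → Fin n → α} {v : β → α} (hu : Measurable u) (hv : Measurable v) :
    Measurable fun b => (Fin.snoc (α := fun _ => α) (u b) (v b) : Fin (n + 1) → α) := by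
  refine measurable_pi_lambda _ fun i => ?_
  induction i using Fin.lastCases with
  | last => simpa using hv
  | cast i => simpa [Function.comp_def] using (measurable_pi_apply i).comp hu

/-- The likelihood of the data `D` given the unknown function: the product of the densities of the
observations. -/
noncomputable def likelihood {Ω X : Type*} (f : X → Ω → ℝ) (σ : ℝ) {n : ℕ} (D : Fin n → X × ℝ)
    (ω : Ω) : ℝ≥0∞ :=
  ∏ i, gaussianPDF (f (D i).1 ω) (σ ^ 2).toNNReal (D i).2

lemma likelihood_snoc {Ω X : Type*} {f : X → Ω → ℝ} {σ : ℝ} {n : ℕ} (D : Fin n → X × ℝ)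
    (x : X) (u : ℝ) (ω : Ω) :
    likelihood f σ (Fin.snoc (α := fun _ => X × ℝ) D (x, u)) ω
      = likelihood f σ D ω * gaussianPDF (f x ω) (σ ^ 2).toNNReal u := by
  simp [likelihood, Fin.prod_univ_castSucc]

/-- The reference measure for the data of the first `n` rounds: the query points follow the rule
`sel`, and the observations are distributed according to Lebesgue measure. -/
noncomputable def refMeasure {X : Type*} [MeasurableSpace X]
    (sel : (n : ℕ) → (Fin n → X × ℝ) → X) : (n : ℕ) → Measure (Fin n → X × ℝ)
  | 0 => Measure.dirac Fin.elim0
  | n + 1 => ((refMeasure sel n).prod volume).map fun q =>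
      Fin.snoc (α := fun _ => X × ℝ) q.1 (sel n q.1, q.2)

lemma refMeasure_zero {X : Type*} [MeasurableSpace X] (sel : (n : ℕ) → (Fin n → X × ℝ) → X) :
    refMeasure sel 0 = Measure.dirac Fin.elim0 := rfl

lemma refMeasure_succ {X : Type*} [MeasurableSpace X] (sel : (n : ℕ) → (Fin n → X × ℝ) → X)
    (n : ℕ) : refMeasure sel (n + 1) = ((refMeasure sel n).prod volume).map fun q =>
      Fin.snoc (α := fun _ => X × ℝ) q.1 (sel n q.1, q.2) := rfl

instance sFinite_refMeasure {X : Type*} [MeasurableSpace X]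
    (sel : (n : ℕ) → (Fin n → X × ℝ) → X) (n : ℕ) : SFinite (refMeasure sel n) := by
  induction n with
  | zero => rw [refMeasure]; infer_instance
  | succ n ih => rw [refMeasure]; infer_instance

namespace IsNoisyGP

variable {Ω X : Type*} [MeasurableSpace Ω] [MeasurableSpace X] {P : Measure Ω}
  {f : X → Ω → ℝ} {k : X → X → ℝ} {ε : ℕ → Ω → ℝ} {σ : ℝ} {n : ℕ}
  {sel : (n : ℕ) → (Fin n → X × ℝ) → X}

/-- Evaluation of the process at a point factors through a jointly measurable function of the point
and the path. Evaluation itself need not be jointly measurable on the space of all paths. -/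
lemma exists_eval (h : IsNoisyGP P f k ε σ) :
    ∃ g : X × (X → ℝ) → ℝ, Measurable g ∧ ∀ x ω, f x ω = g (x, fun x => f x ω) := by
  have h1 : MeasurableSpace.prod inferInstance (funSigma f)
      = MeasurableSpace.comap (fun p : X × Ω => (p.1, fun x => f x p.2)) inferInstance := by
    rw [MeasurableSpace.prod, Prod.instMeasurableSpace, MeasurableSpace.prod,
      MeasurableSpace.comap_sup, MeasurableSpace.comap_comp, MeasurableSpace.comap_comp,
      MeasurableSpace.comap_comp]
    rfl
  have h2 := h.jointly_measurable
  rw [h1] at h2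
  obtain ⟨g, hg, he⟩ := h2.exists_eq_measurable_comp
  exact ⟨g, hg, fun x ω => congrFun he (x, ω)⟩

lemma variance_ne_zero (h : IsNoisyGP P f k ε σ) : (σ ^ 2).toNNReal ≠ 0 := by
  have := pow_pos h.sigma_pos 2
  simpa only [ne_eq, Real.toNNReal_eq_zero, not_le] using this

lemma measurable_data (h : IsNoisyGP P f k ε σ) (hsel : ∀ n, Measurable (sel n)) (n : ℕ) :
    Measurable (data sel f ε n) := by
  induction n with
  | zero => exact measurable_pi_lambda _ fun i => i.elim0
  | succ n ih =>
    have hx := (hsel n).comp ih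
    exact measurable_snoc ih (hx.prodMk
      ((h.measurable_uncurry.comp (hx.prodMk measurable_id)).add (h.noise.measurable n)))

lemma measurable_likelihood (h : IsNoisyGP P f k ε σ) :
    Measurable fun q : (Fin n → X × ℝ) × Ω => likelihood f σ q.1 q.2 := by
  refine Finset.measurable_prod _ fun i _ => ?_
  have h1 : Measurable fun q : (Fin n → X × ℝ) × Ω => q.1 i := by fun_prop
  exact measurable_uncurry_gaussianPDF.comp
    ((h.measurable_uncurry.comp (h1.fst.prodMk measurable_snd)).prodMk
      (measurable_const.prodMk h1.snd))

lemma measurable_likelihood_left (h : IsNoisyGP P f k ε σ) (D : Fin n → X × ℝ) :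
    Measurable fun ω => likelihood f σ D ω :=
  Finset.measurable_prod _ fun i _ => measurable_uncurry_gaussianPDF.comp
    ((h.measurable (D i).1).prodMk (measurable_const.prodMk measurable_const))

lemma exists_data_eq (h : IsNoisyGP P f k ε σ) (hsel : ∀ n, Measurable (sel n)) (n : ℕ) :
    ∃ G : (X → ℝ) × (Fin n → ℝ) → Fin n → X × ℝ, Measurable G ∧
      ∀ ω, data sel f ε n ω = G (fun x => f x ω, fun i => ε i ω) := by
  obtain ⟨g, hg, hgf⟩ := h.exists_eval
  induction n with
  | zero => exact ⟨fun _ => Fin.elim0, measurable_const, fun ω => rfl⟩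
  | succ n ih =>
    obtain ⟨G, hG, hGd⟩ := ih
    have h1 : Measurable fun q : (X → ℝ) × (Fin (n + 1) → ℝ) =>
        G (q.1, fun i => q.2 i.castSucc) := hG.comp (by fun_prop)
    have h2 := (hsel n).comp h1
    refine ⟨fun q => Fin.snoc (α := fun _ => X × ℝ) (G (q.1, fun i => q.2 i.castSucc))
      (sel n (G (q.1, fun i => q.2 i.castSucc)),
        g (sel n (G (q.1, fun i => q.2 i.castSucc)), q.1) + q.2 (Fin.last n)), ?_, fun ω => ?_⟩
    · exact measurable_snoc h1 (h2.prodMk ((hg.comp (h2.prodMk measurable_fst)).add (by fun_prop)))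
    · rw [data, hgf, hGd]
      rfl

variable [IsProbabilityMeasure P]

/-- The noise of a round is independent of the unknown function and the data of earlier rounds. -/
lemma indepFun_data_noise (h : IsNoisyGP P f k ε σ) (hsel : ∀ n, Measurable (sel n)) (n : ℕ) :
    IndepFun (fun ω => (data sel f ε n ω, fun x => f x ω)) (ε n) P := by
  obtain ⟨G, hG, hGd⟩ := h.exists_data_eq hsel n
  have hU : Measurable fun ω (i : Fin n) => ε i ω :=
    measurable_pi_lambda _ fun i => h.noise.measurable i
  have h1 : IndepFun (fun ω x => f x ω) (fun ω => ((fun i : Fin n => ε i ω), ε n ω)) P :=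
    h.indep.comp (φ := id) (ψ := fun e : ℕ → ℝ => ((fun i : Fin n => e i), e n))
      measurable_id (by fun_prop)
  have h2 : IndepFun (fun ω (i : Fin n) => ε i ω) (ε n) P := by
    have h3 := h.noise.indep.indepFun_finset (Finset.range n) {n} (by simp) h.noise.measurable
    have hφ : Measurable fun (e : {m // m ∈ Finset.range n} → ℝ) (i : Fin n) =>
        e ⟨i, Finset.mem_range.2 i.isLt⟩ := measurable_pi_lambda _ fun i => measurable_pi_apply _
    have hψ : Measurable fun e : {m // m ∈ ({n} : Finset ℕ)} → ℝ =>
        e ⟨n, Finset.mem_singleton_self n⟩ := measurable_pi_apply _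
    exact h3.comp hφ hψ
  have h4 := indepFun_prodMk_left h.measurable_path hU (h.noise.measurable n) h1 h2
  simp_rw [hGd]
  exact h4.comp (φ := fun q => (G q, q.1)) (ψ := id) (hG.prodMk measurable_fst) measurable_id

/-- The joint law of the adaptively collected data and the unknown function has the likelihood as
its density with respect to the product of the reference measure and the law of the function: given
the data, the way the query points were chosen does not enter. -/
lemma lintegral_data_eq (h : IsNoisyGP P f k ε σ) (hsel : ∀ n, Measurable (sel n)) (n : ℕ)
    {H : (Fin n → X × ℝ) × (X → ℝ) → ℝ≥0∞} (hH : Measurable H) :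
    ∫⁻ ω, H (data sel f ε n ω, fun x => f x ω) ∂P
      = ∫⁻ D, ∫⁻ ω, H (D, fun x => f x ω) * likelihood f σ D ω ∂P ∂refMeasure sel n := by
  induction n with
  | zero =>
    have : ∀ D : Fin 0 → X × ℝ, D = Fin.elim0 := fun D => Subsingleton.elim _ _
    rw [refMeasure, lintegral_dirac]
    simp [likelihood, data]
  | succ n ih =>
    obtain ⟨g, hg, hgf⟩ := h.exists_eval
    have hx : Measurable fun q : ((Fin n → X × ℝ) × (X → ℝ)) × ℝ => sel n q.1.1 :=
      (hsel n).comp measurable_fst.fst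
    have hgx : Measurable fun q : ((Fin n → X × ℝ) × (X → ℝ)) × ℝ => g (sel n q.1.1, q.1.2) :=
      hg.comp (hx.prodMk measurable_fst.snd)
    have hH1 : Measurable fun q : ((Fin n → X × ℝ) × (X → ℝ)) × ℝ =>
        H (Fin.snoc (α := fun _ => X × ℝ) q.1.1 (sel n q.1.1, q.2), q.1.2) :=
      hH.comp ((measurable_snoc measurable_fst.fst (hx.prodMk measurable_snd)).prodMk
        measurable_fst.snd)
    have hpdf : Measurable fun q : ((Fin n → X × ℝ) × (X → ℝ)) × ℝ =>
        gaussianPDF (g (sel n q.1.1, q.1.2)) (σ ^ 2).toNNReal q.2 :=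
      measurable_uncurry_gaussianPDF.comp (hgx.prodMk (measurable_const.prodMk measurable_snd))
    -- the noise is integrated out first, given the function and the earlier data
    have e1 : ∫⁻ ω, H (data sel f ε (n + 1) ω, fun x => f x ω) ∂P
        = ∫⁻ ω, ∫⁻ u, H (Fin.snoc (α := fun _ => X × ℝ) (data sel f ε n ω)
            (sel n (data sel f ε n ω), u), fun x => f x ω)
          * gaussianPDF (g (sel n (data sel f ε n ω), fun x => f x ω)) (σ ^ 2).toNNReal u
          ∂volume ∂P := by
      have := lintegral_indepFun ((h.measurable_data hsel n).prodMk h.measurable_path)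
        (h.noise.measurable n) (h.indepFun_data_noise hsel n)
        (hH1.comp (measurable_fst.prodMk (hgx.add measurable_snd)))
      simp only [Function.comp_def, Pi.add_apply, h.noise.law n] at this
      have e0 : ∀ ω, data sel f ε (n + 1) ω = Fin.snoc (α := fun _ => X × ℝ) (data sel f ε n ω)
          (sel n (data sel f ε n ω),
            g (sel n (data sel f ε n ω), fun x => f x ω) + ε n ω) := fun ω => by
        rw [data, hgf]
      simp_rw [e0]
      rw [this]
      refine lintegral_congr fun ω => ?_
      set q : (Fin n → X × ℝ) × (X → ℝ) := (data sel f ε n ω, fun x => f x ω) with hq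
      set m := g (sel n q.1, q.2) with hm
      have hs : Measurable fun u : ℝ =>
          H (Fin.snoc (α := fun _ => X × ℝ) q.1 (sel n q.1, u), q.2) :=
        hH1.comp (measurable_const.prodMk measurable_id)
      have hmap := gaussianReal_map_const_add (μ := 0) (v := (σ ^ 2).toNNReal) m
      rw [zero_add] at hmap
      calc ∫⁻ e, H (Fin.snoc (α := fun _ => X × ℝ) q.1 (sel n q.1, m + e), q.2)
            ∂gaussianReal 0 (σ ^ 2).toNNReal
          = ∫⁻ u, H (Fin.snoc (α := fun _ => X × ℝ) q.1 (sel n q.1, u), q.2)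
            ∂gaussianReal m (σ ^ 2).toNNReal := by
            rw [← hmap, lintegral_map hs (measurable_const_add m)]
        _ = _ := by
            rw [gaussianReal_of_var_ne_zero _ h.variance_ne_zero,
              lintegral_withDensity_eq_lintegral_mul _ (measurable_gaussianPDF _ _) hs]
            exact lintegral_congr fun u => mul_comm _ _
    have hH' : Measurable fun q : (Fin n → X × ℝ) × (X → ℝ) =>
        ∫⁻ u, H (Fin.snoc (α := fun _ => X × ℝ) q.1 (sel n q.1, u), q.2)
          * gaussianPDF (g (sel n q.1, q.2)) (σ ^ 2).toNNReal u :=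
      (hH1.mul hpdf).lintegral_prod_right'
    have hmapm : Measurable fun q : (Fin n → X × ℝ) × ℝ =>
        (Fin.snoc (α := fun _ => X × ℝ) q.1 (sel n q.1, q.2) : Fin (n + 1) → X × ℝ) :=
      measurable_snoc measurable_fst (((hsel n).comp measurable_fst).prodMk measurable_snd)
    have hHP : Measurable fun q : (Fin (n + 1) → X × ℝ) × Ω =>
        H (q.1, fun x => f x q.2) * likelihood f σ q.1 q.2 :=
      (hH.comp (measurable_fst.prodMk (h.measurable_path.comp measurable_snd))).mul
        h.measurable_likelihood
    have hHm := hHP.lintegral_prod_right' (ν := P) |>.comp hmapm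
    rw [e1, ih hH', refMeasure, lintegral_map hHP.lintegral_prod_right' hmapm]
    refine Eq.trans ?_ (lintegral_prod _ hHm.aemeasurable).symm
    refine lintegral_congr fun D => ?_
    have hsw : Measurable fun q : Ω × ℝ => H (Fin.snoc (α := fun _ => X × ℝ) D (sel n D, q.2),
        fun x => f x q.1) * gaussianPDF (g (sel n D, fun x => f x q.1)) (σ ^ 2).toNNReal q.2
        * likelihood f σ D q.1 :=
      ((hH1.mul hpdf).comp ((measurable_const.prodMk
        (h.measurable_path.comp measurable_fst)).prodMk measurable_snd)).mul
        ((h.measurable_likelihood_left D).comp measurable_fst)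
    have e2 : ∀ ω, (∫⁻ u, H (Fin.snoc (α := fun _ => X × ℝ) D (sel n D, u), fun x => f x ω)
          * gaussianPDF (g (sel n D, fun x => f x ω)) (σ ^ 2).toNNReal u) * likelihood f σ D ω
        = ∫⁻ u, H (Fin.snoc (α := fun _ => X × ℝ) D (sel n D, u), fun x => f x ω)
          * gaussianPDF (g (sel n D, fun x => f x ω)) (σ ^ 2).toNNReal u
          * likelihood f σ D ω := fun ω => by
      rw [lintegral_mul_const]
      exact (hH1.mul hpdf).comp (g := fun q => _)
        (measurable_prodMk_left (x := ((D, fun x => f x ω) : (Fin n → X × ℝ) × (X → ℝ))))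
    simp_rw [e2]
    refine (lintegral_lintegral_swap hsw.aemeasurable).trans ?_
    refine lintegral_congr fun u => lintegral_congr fun ω => ?_
    rw [likelihood_snoc, hgf (sel n D) ω]
    ring

end IsNoisyGP

/-! ### Bayes' formula -/

namespace IsNoisyGP

lemma likelihood_le {Ω X : Type*} {f : X → Ω → ℝ} {σ : ℝ} {n : ℕ} (D : Fin n → X × ℝ) (ω : Ω) :
    likelihood f σ D ω
      ≤ ENNReal.ofReal (√(2 * Real.pi * (σ ^ 2).toNNReal))⁻¹ ^ n := by
  refine (Finset.prod_le_prod' fun i _ => gaussianPDF_le _ _ _).trans ?_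
  simp

lemma continuous_likelihood {Ω X : Type*} {f : X → Ω → ℝ} {σ : ℝ} {n : ℕ} (b : Fin n → X) (ω : Ω) :
    Continuous fun y : Fin n → ℝ => likelihood f σ (fun i => (b i, y i)) ω := by
  have h1 : (fun y : Fin n → ℝ => likelihood f σ (fun i => (b i, y i)) ω)
      = fun y => ENNReal.ofReal (∏ i, gaussianPDFReal (f (b i) ω) (σ ^ 2).toNNReal (y i)) := by
    funext y
    rw [ENNReal.ofReal_prod_of_nonneg fun i _ => gaussianPDFReal_nonneg _ _ _]
    rfl
  rw [h1]
  refine ENNReal.continuous_ofReal.comp ?_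
  unfold gaussianPDFReal
  fun_prop

lemma data_const {Ω X : Type*} (f : X → Ω → ℝ) (ε : ℕ → Ω → ℝ) (b : ℕ → X) (n : ℕ) (ω : Ω) :
    data (fun n _ => b n) f ε n ω = fun i : Fin n =>
      (b i, fixedObs f ε (fun i : Fin n => b i) i ω) := by
  induction n with
  | zero => exact Subsingleton.elim _ _
  | succ n ih =>
    rw [data, ih]
    funext i
    induction i using Fin.lastCases with
    | last => simp [fixedObs]
    | cast i => simp [fixedObs]

/-- For query points fixed in advance, the reference measure is Lebesgue measure on the vectors of
observations. -/
lemma refMeasure_const {X : Type*} [MeasurableSpace X] (b : ℕ → X) (n : ℕ) :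
    refMeasure (fun n _ => b n) n
      = (volume : Measure (Fin n → ℝ)).map fun (y : Fin n → ℝ) (i : Fin n) => (b i, y i) := by
  induction n with
  | zero =>
    rw [refMeasure_zero, volume_pi, Measure.pi_of_empty (x := fun i => i.elim0), Measure.map_dirac]
    congr 1
    exact Subsingleton.elim _ _
  | succ n ih =>
    have hm : ∀ n : ℕ, Measurable fun (y : Fin n → ℝ) (i : Fin n) => (b i, y i) := fun n => by
      fun_prop
    have hp := volume_preserving_piFinSuccAbove (fun _ : Fin (n + 1) => ℝ) (Fin.last n)
    rw [refMeasure_succ, ih]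
    have hpr : ((volume : Measure (Fin n → ℝ)).map
        fun (y : Fin n → ℝ) (i : Fin n) => (b i, y i)).prod (volume : Measure ℝ)
        = ((volume : Measure (Fin n → ℝ)).prod (volume : Measure ℝ)).map
          (Prod.map (fun (y : Fin n → ℝ) (i : Fin n) => (b i, y i)) id) := by
      conv_lhs => rw [← Measure.map_id (μ := (volume : Measure ℝ))]
      rw [Measure.map_prod_map _ _ (hm n) measurable_id]
    have hs := measurable_snoc (α := X × ℝ) (β := (Fin n → X × ℝ) × ℝ) (n := n)
      (u := Prod.fst) (v := fun q => (b n, q.2)) measurable_fst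
      (measurable_const.prodMk measurable_snd)
    rw [hpr, Measure.map_map hs ((hm n).prodMap measurable_id), ← Measure.prod_swap,
      Measure.map_map (hs.comp ((hm n).prodMap measurable_id)) measurable_swap]
    have hv : (volume : Measure ℝ).prod (volume : Measure (Fin n → ℝ))
        = (volume : Measure (Fin (n + 1) → ℝ)).map
          (MeasurableEquiv.piFinSuccAbove (fun _ : Fin (n + 1) => ℝ) (Fin.last n)) :=
      hp.map_eq.symm
    rw [hv, Measure.map_map ((hs.comp ((hm n).prodMap measurable_id)).comp measurable_swap)
      (MeasurableEquiv.measurable _)]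
    congr 1
    funext y i
    induction i using Fin.lastCases with
    | last => simp [MeasurableEquiv.piFinSuccAbove, Fin.insertNthEquiv]
    | cast i => simp [MeasurableEquiv.piFinSuccAbove, Fin.insertNthEquiv, Fin.init]

variable {Ω X : Type*} [MeasurableSpace Ω] [MeasurableSpace X] {P : Measure Ω}
  [IsProbabilityMeasure P] {f : X → Ω → ℝ} {k : X → X → ℝ} {ε : ℕ → Ω → ℝ} {σ : ℝ} {n : ℕ}
  {sel : (n : ℕ) → (Fin n → X × ℝ) → X}

/-- The likelihood formula for query points that are fixed in advance. -/
lemma lintegral_fixedObs_eq (h : IsNoisyGP P f k ε σ) (b : ℕ → X) (n : ℕ)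
    {H : (Fin n → ℝ) × (X → ℝ) → ℝ≥0∞} (hH : Measurable H) :
    ∫⁻ ω, H (fun i => fixedObs f ε (fun i : Fin n => b i) i ω, fun x => f x ω) ∂P
      = ∫⁻ y, ∫⁻ ω, H (y, fun x => f x ω)
        * likelihood f σ (fun i : Fin n => (b i, y i)) ω ∂P := by
  have hH' : Measurable fun q : (Fin n → X × ℝ) × (X → ℝ) => H (fun i => (q.1 i).2, q.2) :=
    hH.comp (by fun_prop)
  have h1 := h.lintegral_data_eq (sel := fun n _ => b n) (fun n => measurable_const) n hH'
  have hm : Measurable fun (y : Fin n → ℝ) (i : Fin n) => (b i, y i) := by fun_prop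
  have hHP : Measurable fun q : (Fin n → X × ℝ) × Ω =>
      H (fun i => (q.1 i).2, fun x => f x q.2) * likelihood f σ q.1 q.2 :=
    (hH'.comp (measurable_fst.prodMk (h.measurable_path.comp measurable_snd))).mul
      h.measurable_likelihood
  rw [refMeasure_const, lintegral_map hHP.lintegral_prod_right' hm] at h1
  simp only [data_const] at h1
  exact h1

lemma map_residual_eq_map_stdGaussian (h : IsNoisyGP P f k ε σ) (D : Fin n → X × ℝ) (z : X) :
    P.map (residual k σ f ε (fun i => (D i).1) z)
      = (gaussianReal 0 1).map fun u => postSD k σ D z * u := by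
  rw [h.map_residual, gaussianReal_map_const_mul, mul_zero, mul_one]
  congr 1
  ext
  have := (h.isPSDKernel.postCov_pos h.sigma_pos D (h.kernel_pos z)).le
  simp [postSD, Real.sq_sqrt this, Real.coe_toNNReal _ this]

lemma continuous_lintegral_mul_likelihood (h : IsNoisyGP P f k ε σ) (b : Fin n → X) {ψ : Ω → ℝ≥0∞}
    (hψ : Measurable ψ) {C : ℝ≥0∞} (hC : C ≠ ∞) (hψC : ∀ ω, ψ ω ≤ C) :
    Continuous fun y : Fin n → ℝ =>
      ∫⁻ ω, ψ ω * likelihood f σ (fun i => (b i, y i)) ω ∂P := by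
  refine continuous_iff_continuousAt.2 fun y => ?_
  refine tendsto_lintegral_filter_of_dominated_convergence
    (fun _ => C * ENNReal.ofReal (√(2 * Real.pi * (σ ^ 2).toNNReal))⁻¹ ^ n) ?_ ?_ ?_ ?_
  · exact Eventually.of_forall fun y => hψ.mul (h.measurable_likelihood_left _)
  · exact Eventually.of_forall fun y => Eventually.of_forall fun ω =>
      mul_le_mul' (hψC ω) (likelihood_le _ ω)
  · rw [lintegral_const, measure_univ, mul_one]
    exact ENNReal.mul_ne_top hC (ENNReal.pow_ne_top ENNReal.ofReal_ne_top)
  · refine Eventually.of_forall fun ω => ?_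
    exact ENNReal.Tendsto.const_mul ((continuous_likelihood b ω).tendsto y)
      (Or.inr (hψC ω |>.trans_lt hC.lt_top).ne)

/-- Bayes' formula for a bounded continuous test function and query points fixed in advance. Both
sides are continuous in the observations, and they agree almost everywhere by the likelihood
formula, since the prediction error is independent of the observations; so they agree
everywhere. -/
lemma lintegral_boundedContinuous_mul_likelihood (h : IsNoisyGP P f k ε σ) (b : ℕ → X) (z : X)
    (y : Fin n → ℝ) (ψ : BoundedContinuousFunction ℝ ℝ≥0) :
    ∫⁻ ω, ψ (f z ω) * likelihood f σ (fun i : Fin n => (b i, y i)) ω ∂P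
      = (∫⁻ u, ψ (postMean k σ (fun i : Fin n => (b i, y i)) z
          + postSD k σ (fun i : Fin n => (b i, y i)) z * u) ∂(gaussianReal 0 1))
        * ∫⁻ ω, likelihood f σ (fun i : Fin n => (b i, y i)) ω ∂P := by
  set a : Fin n → X := fun i => b i with ha
  set c := coeffs k σ a z with hc
  set s := postSD k σ (fun i : Fin n => (b i, (0 : ℝ))) z with hs
  have hsd : ∀ y : Fin n → ℝ, postSD k σ (fun i : Fin n => (b i, y i)) z = s := fun y => rfl
  have hmean : ∀ y : Fin n → ℝ, postMean k σ (fun i : Fin n => (b i, y i)) z = ∑ i, c i * y i :=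
    fun y => h.isPSDKernel.postMean_eq _ z
  set B : (Fin n → ℝ) → ℝ≥0∞ := fun y =>
    ∫⁻ u, ψ (∑ i, c i * y i + s * u) ∂(gaussianReal 0 1) with hB
  set p : (Fin n → ℝ) → ℝ≥0∞ := fun y =>
    ∫⁻ ω, likelihood f σ (fun i : Fin n => (b i, y i)) ω ∂P with hp
  set A : (Fin n → ℝ) → ℝ≥0∞ := fun y =>
    ∫⁻ ω, ψ (f z ω) * likelihood f σ (fun i : Fin n => (b i, y i)) ω ∂P with hA
  obtain ⟨C, hC⟩ : ∃ C : ℝ≥0, ∀ t, ψ t ≤ C := ⟨nndist ψ 0, fun t => by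
    simpa [NNReal.nndist_zero_eq_val'] using ψ.nndist_coe_le_nndist t (g := 0)⟩
  have hψm : Measurable fun t => (ψ t : ℝ≥0∞) := ψ.continuous.measurable.coe_nnreal_ennreal
  have hAc : Continuous A := h.continuous_lintegral_mul_likelihood a
    (hψm.comp (h.measurable z)) ENNReal.coe_ne_top fun ω => ENNReal.coe_le_coe.2 (hC _)
  have hpc : Continuous p := by
    simpa using h.continuous_lintegral_mul_likelihood a (ψ := fun _ => 1) measurable_const
      ENNReal.one_ne_top fun _ => le_rfl
  have hpt : ∀ y, p y ≠ ∞ := fun y => by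
    refine ((lintegral_mono fun ω => likelihood_le _ ω).trans_lt ?_).ne
    rw [lintegral_const, measure_univ, mul_one]
    exact ENNReal.pow_lt_top ENNReal.ofReal_lt_top
  have hBle : ∀ y, B y ≤ C := fun y => by
    refine (lintegral_mono fun u => ENNReal.coe_le_coe.2 (hC _)).trans ?_
    simp
  have hBc : Continuous B := by
    refine continuous_iff_continuousAt.2 fun y => ?_
    refine tendsto_lintegral_filter_of_dominated_convergence (fun _ => (C : ℝ≥0∞)) ?_ ?_ ?_ ?_
    · exact Eventually.of_forall fun y => hψm.comp (by fun_prop)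
    · exact Eventually.of_forall fun y => Eventually.of_forall fun u => ENNReal.coe_le_coe.2 (hC _)
    · simp
    · refine Eventually.of_forall fun u => ENNReal.tendsto_coe.2 ?_
      exact (ψ.continuous.comp (by fun_prop :
        Continuous fun y : Fin n → ℝ => ∑ i, c i * y i + s * u)).tendsto y
  have hBp : Continuous fun y => B y * p y := continuous_iff_continuousAt.2 fun y =>
    ENNReal.Tendsto.mul (hBc.tendsto y) (Or.inr (hpt y)) (hpc.tendsto y)
      (Or.inr ((hBle y).trans_lt ENNReal.coe_lt_top).ne)
  have hY : Measurable fun ω i => fixedObs f ε a i ω :=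
    measurable_pi_lambda _ fun i => h.measurable_fixedObs a i
  have hae : A =ᵐ[volume] fun y => B y * p y := by
    refine ae_eq_of_forall_setLIntegral_eq_of_sigmaFinite hAc.measurable hBp.measurable
      fun S hS _ => ?_
    set χ : (Fin n → ℝ) → ℝ≥0∞ := S.indicator 1 with hχ
    have hχm : Measurable χ := measurable_one.indicator hS
    have hind : ∀ F : (Fin n → ℝ) → ℝ≥0∞, ∫⁻ y in S, F y = ∫⁻ y, χ y * F y := fun F => by
      rw [← lintegral_indicator hS]
      refine lintegral_congr fun y => ?_
      by_cases hy : y ∈ S <;> simp [hχ, hy]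
    rw [hind, hind]
    -- `f z` is the sum of the prediction and of the error, which is independent of the data
    have h1 : ∫⁻ ω, χ (fun i => fixedObs f ε a i ω) * ψ (f z ω) ∂P
        = ∫⁻ ω, χ (fun i => fixedObs f ε a i ω) * B (fun i => fixedObs f ε a i ω) ∂P := by
      have hH : Measurable fun q : (Fin n → ℝ) × ℝ => χ q.1 * ψ (∑ i, c i * q.1 i + q.2) :=
        (hχm.comp measurable_fst).mul (hψm.comp (by fun_prop))
      have h2 := lintegral_indepFun hY (h.measurable_residual a z)
        (h.indepFun_residual_fixedObs a z).symm hH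
      have hres : ∀ ω, ∑ i, c i * fixedObs f ε a i ω + residual k σ f ε a z ω = f z ω :=
        fun ω => by rw [residual]; ring
      simp only [hres] at h2
      rw [h2]
      refine lintegral_congr fun ω => ?_
      have hm1 : Measurable fun v : ℝ => (ψ (∑ i, c i * fixedObs f ε a i ω + v) : ℝ≥0∞) :=
        hψm.comp (measurable_const_add _)
      rw [lintegral_const_mul _ hm1]
      congr 1
      have h3 := h.map_residual_eq_map_stdGaussian (fun i : Fin n => (b i, (0 : ℝ))) z
      change P.map (residual k σ f ε a z) = _ at h3
      rw [h3, lintegral_map hm1 (by fun_prop)]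
    have h4 := h.lintegral_fixedObs_eq b n
      (H := fun q => χ q.1 * ψ (q.2 z)) ((hχm.comp measurable_fst).mul (hψm.comp
        ((measurable_pi_apply z).comp measurable_snd)))
    have h5 := h.lintegral_fixedObs_eq b n
      (H := fun q => χ q.1 * B q.1) ((hχm.comp measurable_fst).mul
        (hBc.measurable.comp measurable_fst))
    have h6 := h4.symm.trans (h1.trans h5)
    refine Eq.trans (lintegral_congr fun y => ?_) (h6.trans (lintegral_congr fun y => ?_))
    · have hm2 : Measurable fun ω => (ψ (f z ω) : ℝ≥0∞)
          * likelihood f σ (fun i : Fin n => (b i, y i)) ω :=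
        (hψm.comp (h.measurable z)).mul (h.measurable_likelihood_left _)
      simp only [hA]
      rw [← lintegral_const_mul _ hm2]
      exact lintegral_congr fun ω => (mul_assoc _ _ _).symm
    · simp only
      rw [lintegral_const_mul _ (h.measurable_likelihood_left fun i : Fin n => (b i, y i)),
        mul_assoc]
  have := congrFun ((hAc.ae_eq_iff_eq volume hBp).1 hae) y
  simp only [hA, hB, hp] at this
  rw [this, hmean, hsd]

/-- Bayes' formula: given the data, `f z` is Gaussian with the posterior mean and standard
deviation. It holds for every value of the data, not only for almost every one. -/
lemma lintegral_mul_likelihood (h : IsNoisyGP P f k ε σ) (D : Fin n → X × ℝ) (z : X)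
    {ψ : ℝ → ℝ≥0∞} (hψ : Measurable ψ) :
    ∫⁻ ω, ψ (f z ω) * likelihood f σ D ω ∂P
      = (∫⁻ u, ψ (postMean k σ D z + postSD k σ D z * u) ∂(gaussianReal 0 1))
        * ∫⁻ ω, likelihood f σ D ω ∂P := by
  have hlm := h.measurable_likelihood_left D
  have hlt : ∫⁻ ω, likelihood f σ D ω ∂P ≠ ∞ := by
    refine ((lintegral_mono fun ω => likelihood_le _ ω).trans_lt ?_).ne
    rw [lintegral_const, measure_univ, mul_one]
    exact ENNReal.pow_lt_top ENNReal.ofReal_lt_top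
  set μ₁ : Measure ℝ := (P.withDensity fun ω => likelihood f σ D ω).map (f z) with hμ₁
  set μ₂ : Measure ℝ := (∫⁻ ω, likelihood f σ D ω ∂P) •
    (gaussianReal 0 1).map fun u => postMean k σ D z + postSD k σ D z * u with hμ₂
  have e1 : ∀ {ψ : ℝ → ℝ≥0∞}, Measurable ψ →
      ∫⁻ t, ψ t ∂μ₁ = ∫⁻ ω, ψ (f z ω) * likelihood f σ D ω ∂P := fun {ψ} hψ => by
    have hm : Measurable fun ω => ψ (f z ω) := hψ.comp (h.measurable z)
    rw [hμ₁, lintegral_map hψ (h.measurable z), lintegral_withDensity_eq_lintegral_mul _ hlm hm]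
    exact lintegral_congr fun ω => mul_comm _ _
  have e2 : ∀ {ψ : ℝ → ℝ≥0∞}, Measurable ψ → ∫⁻ t, ψ t ∂μ₂
      = (∫⁻ u, ψ (postMean k σ D z + postSD k σ D z * u) ∂(gaussianReal 0 1))
        * ∫⁻ ω, likelihood f σ D ω ∂P := fun {ψ} hψ => by
    rw [hμ₂, lintegral_smul_measure, lintegral_map hψ (by fun_prop), smul_eq_mul, mul_comm]
  have : IsFiniteMeasure (P.withDensity fun ω => likelihood f σ D ω) :=
    isFiniteMeasure_withDensity hlt
  have hμ : μ₁ = μ₂ := by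
    refine ext_of_forall_lintegral_eq_of_IsFiniteMeasure fun ψ => ?_
    have hψm : Measurable fun t => (ψ t : ℝ≥0∞) := ψ.continuous.measurable.coe_nnreal_ennreal
    rw [e1 hψm, e2 hψm]
    set b : ℕ → X := fun m => if hm : m < n then (D ⟨m, hm⟩).1 else z with hb
    have hD : D = fun i : Fin n => (b i, (D i).2) := by
      funext i; simp [hb]
    rw [hD]
    exact h.lintegral_boundedContinuous_mul_likelihood b z (fun i => (D i).2) ψ
  rw [← e1 hψ, ← e2 hψ, hμ]

end IsNoisyGP

/-! ### The conditional law of the value at the query point -/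

lemma measurable_matrix_det {α : Type*} [MeasurableSpace α] {n : ℕ}
    {M : α → Matrix (Fin n) (Fin n) ℝ} (hM : ∀ i j, Measurable fun q => M q i j) :
    Measurable fun q => (M q).det := by
  simp only [det_apply]
  exact Finset.measurable_sum _ fun τ _ =>
    (Finset.measurable_prod _ fun i _ => hM (τ i) i).const_smul _

lemma measurable_matrix_inv {α : Type*} [MeasurableSpace α] {n : ℕ}
    {M : α → Matrix (Fin n) (Fin n) ℝ} (hM : ∀ i j, Measurable fun q => M q i j) (i j : Fin n) :
    Measurable fun q => (M q)⁻¹ i j := by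
  have h : ∀ q, (M q)⁻¹ i j = (M q).det⁻¹ * ((M q).updateRow j (Pi.single i 1)).det := fun q => by
    rw [inv_def, Ring.inverse_eq_inv', Matrix.smul_apply, smul_eq_mul, adjugate_apply]
  simp_rw [h]
  refine (measurable_matrix_det hM).inv.mul (measurable_matrix_det fun l m => ?_)
  by_cases hl : l = j
  · subst hl; simp
  · simpa [updateRow_ne hl] using hM l m

lemma data_apply {Ω X : Type*} (sel : (n : ℕ) → (Fin n → X × ℝ) → X) (f : X → Ω → ℝ)
    (ε : ℕ → Ω → ℝ) (n : ℕ) (ω : Ω) (i : Fin n) :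
    data sel f ε n ω i = (query sel f ε i ω, f (query sel f ε i ω) ω + ε i ω) := by
  induction n with
  | zero => exact i.elim0
  | succ n ih =>
    rw [data]
    induction i using Fin.lastCases with
    | last => simp [query]
    | cast i => simpa using ih i

/-- The standardized error of the posterior mean at the query point. -/
noncomputable def innovation {Ω X : Type*} (k : X → X → ℝ) (σ : ℝ)
    (sel : (n : ℕ) → (Fin n → X × ℝ) → X) (f : X → Ω → ℝ) (ε : ℕ → Ω → ℝ) (n : ℕ) (ω : Ω) : ℝ :=
  (f (query sel f ε n ω) ω - postMean k σ (data sel f ε n ω) (query sel f ε n ω))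
    / postSD k σ (data sel f ε n ω) (query sel f ε n ω)

namespace IsNoisyGP

variable {Ω X : Type*} [MeasurableSpace Ω] [MeasurableSpace X] {P : Measure Ω}
  {f : X → Ω → ℝ} {k : X → X → ℝ} {ε : ℕ → Ω → ℝ} {σ : ℝ} {n : ℕ}
  {sel : (n : ℕ) → (Fin n → X × ℝ) → X}

lemma measurable_query (h : IsNoisyGP P f k ε σ) (hsel : ∀ n, Measurable (sel n)) (n : ℕ) :
    Measurable (query sel f ε n) :=
  (hsel n).comp (h.measurable_data hsel n)

lemma measurable_data_query (h : IsNoisyGP P f k ε σ) (hsel : ∀ n, Measurable (sel n)) (n : ℕ) :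
    Measurable fun ω => (data sel f ε n ω, query sel f ε n ω) :=
  (h.measurable_data hsel n).prodMk (h.measurable_query hsel n)

lemma measurable_eval_query (h : IsNoisyGP P f k ε σ) (hsel : ∀ n, Measurable (sel n)) (n : ℕ) :
    Measurable fun ω => f (query sel f ε n ω) ω :=
  h.measurable_uncurry.comp ((h.measurable_query hsel n).prodMk measurable_id)

variable [IsProbabilityMeasure P]

lemma measurable_kernel_comp (h : IsNoisyGP P f k ε σ) {α : Type*} [MeasurableSpace α]
    {u v : α → X} (hu : Measurable u) (hv : Measurable v) :
    Measurable fun q => k (u q) (v q) :=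
  h.measurable_kernel.comp (hu.prodMk hv)

lemma measurable_obsMatrix_inv (h : IsNoisyGP P f k ε σ) (i j : Fin n) :
    Measurable fun q : (Fin n → X × ℝ) × X => (kernelMatrix k (fun i => (q.1 i).1)
      + σ ^ 2 • (1 : Matrix (Fin n) (Fin n) ℝ))⁻¹ i j := by
  refine measurable_matrix_inv (fun i j => ?_) i j
  exact (h.measurable_kernel_comp (α := (Fin n → X × ℝ) × X) (u := fun q => (q.1 i).1)
    (v := fun q => (q.1 j).1) (by fun_prop) (by fun_prop)).add measurable_const

lemma measurable_postMean (h : IsNoisyGP P f k ε σ) :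
    Measurable fun q : (Fin n → X × ℝ) × X => postMean k σ q.1 q.2 := by
  unfold postMean
  simp only [dotProduct, mulVec]
  refine Finset.measurable_sum _ fun i _ => Measurable.mul ?_ ?_
  · exact h.measurable_kernel_comp (α := (Fin n → X × ℝ) × X) (u := fun q => (q.1 i).1)
      (v := fun q => q.2) (by fun_prop) (by fun_prop)
  · exact Finset.measurable_sum _ fun j _ => (h.measurable_obsMatrix_inv i j).mul (by fun_prop)

lemma measurable_postSD (h : IsNoisyGP P f k ε σ) :
    Measurable fun q : (Fin n → X × ℝ) × X => postSD k σ q.1 q.2 := by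
  unfold postSD postCov
  simp only [dotProduct, mulVec]
  refine Real.continuous_sqrt.measurable.comp (Measurable.sub ?_ ?_)
  · exact h.measurable_kernel_comp measurable_snd measurable_snd
  · have hv : ∀ i, Measurable fun q : (Fin n → X × ℝ) × X => k (q.1 i).1 q.2 := fun i =>
      h.measurable_kernel_comp (α := (Fin n → X × ℝ) × X) (u := fun q => (q.1 i).1)
        (v := fun q => q.2) (by fun_prop) (by fun_prop)
    exact Finset.measurable_sum _ fun i _ => (hv i).mul
      (Finset.measurable_sum _ fun j _ => (h.measurable_obsMatrix_inv i j).mul (hv j))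

lemma postSD_pos (h : IsNoisyGP P f k ε σ) (D : Fin n → X × ℝ) (x : X) : 0 < postSD k σ D x :=
  Real.sqrt_pos.2 (h.isPSDKernel.postCov_pos h.sigma_pos D (h.kernel_pos x))

lemma postSD_sq (h : IsNoisyGP P f k ε σ) (D : Fin n → X × ℝ) (x : X) :
    postSD k σ D x ^ 2 = postCov k σ D x x :=
  Real.sq_sqrt (h.isPSDKernel.postCov_pos h.sigma_pos D (h.kernel_pos x)).le

lemma postSD_le_one (h : IsNoisyGP P f k ε σ) (D : Fin n → X × ℝ) (x : X) : postSD k σ D x ≤ 1 :=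
  Real.sqrt_le_one.2 ((h.isPSDKernel.postCov_le h.sigma_pos D x).trans (h.kernel_le x x))

/-- Given the adaptively collected data, the value at the query point is Gaussian with the posterior
mean and standard deviation. -/
lemma lintegral_data_query (h : IsNoisyGP P f k ε σ) (hsel : ∀ n, Measurable (sel n)) (n : ℕ)
    {Ψ : (Fin n → X × ℝ) × ℝ → ℝ≥0∞} (hΨ : Measurable Ψ) :
    ∫⁻ ω, Ψ (data sel f ε n ω, f (query sel f ε n ω) ω) ∂P
      = ∫⁻ ω, ∫⁻ u, Ψ (data sel f ε n ω, postMean k σ (data sel f ε n ω) (query sel f ε n ω)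
        + postSD k σ (data sel f ε n ω) (query sel f ε n ω) * u) ∂(gaussianReal 0 1) ∂P := by
  obtain ⟨g, hg, hgf⟩ := h.exists_eval
  have hD : Measurable fun D : Fin n → X × ℝ => (D, sel n D) := measurable_id.prodMk (hsel n)
  have hΨ' : Measurable fun D : Fin n → X × ℝ => ∫⁻ u, Ψ (D, postMean k σ D (sel n D)
      + postSD k σ D (sel n D) * u) ∂(gaussianReal 0 1) := by
    have h1 : Measurable fun q : (Fin n → X × ℝ) × ℝ => Ψ (q.1, postMean k σ q.1 (sel n q.1)
        + postSD k σ q.1 (sel n q.1) * q.2) :=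
      hΨ.comp (measurable_fst.prodMk (((h.measurable_postMean.comp hD).comp measurable_fst).add
        (((h.measurable_postSD.comp hD).comp measurable_fst).mul measurable_snd)))
    exact h1.lintegral_prod_right'
  have e1 := h.lintegral_data_eq hsel n (H := fun q => Ψ (q.1, g (sel n q.1, q.2)))
    (hΨ.comp (measurable_fst.prodMk
      (hg.comp (((hsel n).comp measurable_fst).prodMk measurable_snd))))
  have e2 := h.lintegral_data_eq hsel n (H := fun q => ∫⁻ u, Ψ (q.1, postMean k σ q.1 (sel n q.1)
    + postSD k σ q.1 (sel n q.1) * u) ∂(gaussianReal 0 1)) (hΨ'.comp measurable_fst)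
  simp only [← hgf] at e1
  refine e1.trans (Eq.trans (lintegral_congr fun D => ?_) e2.symm)
  simp only
  rw [lintegral_const_mul _ (h.measurable_likelihood_left D)]
  exact h.lintegral_mul_likelihood D (sel n D) (ψ := fun t => Ψ (D, t))
    (hΨ.comp measurable_prodMk_left)

lemma measurable_innovation (h : IsNoisyGP P f k ε σ) (hsel : ∀ n, Measurable (sel n)) (n : ℕ) :
    Measurable (innovation k σ sel f ε n) :=
  ((h.measurable_eval_query hsel n).sub
    (h.measurable_postMean.comp (h.measurable_data_query hsel n))).div
    (h.measurable_postSD.comp (h.measurable_data_query hsel n))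

lemma eval_query_eq (h : IsNoisyGP P f k ε σ) (n : ℕ) (ω : Ω) :
    f (query sel f ε n ω) ω = postMean k σ (data sel f ε n ω) (query sel f ε n ω)
      + postSD k σ (data sel f ε n ω) (query sel f ε n ω) * innovation k σ sel f ε n ω := by
  rw [innovation, mul_div_cancel₀ _ (h.postSD_pos _ _).ne']
  ring

/-- The standardized error of the posterior mean is standard Gaussian and independent of the
data. -/
lemma map_data_innovation (h : IsNoisyGP P f k ε σ) (hsel : ∀ n, Measurable (sel n)) (n : ℕ) :
    P.map (fun ω => (data sel f ε n ω, innovation k σ sel f ε n ω))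
      = (P.map (data sel f ε n)).prod (gaussianReal 0 1) := by
  have hd := h.measurable_data hsel n
  have hi := h.measurable_innovation hsel n
  refine Measure.ext_of_lintegral _ fun χ hχ => ?_
  rw [lintegral_map hχ (hd.prodMk hi), lintegral_prod _ hχ.aemeasurable,
    lintegral_map hχ.lintegral_prod_right' hd]
  have hD : Measurable fun q : (Fin n → X × ℝ) × ℝ => (q.1, sel n q.1) :=
    measurable_fst.prodMk ((hsel n).comp measurable_fst)
  have hΨ : Measurable fun q : (Fin n → X × ℝ) × ℝ =>
      χ (q.1, (q.2 - postMean k σ q.1 (sel n q.1)) / postSD k σ q.1 (sel n q.1)) :=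
    hχ.comp (measurable_fst.prodMk ((measurable_snd.sub (h.measurable_postMean.comp hD)).div
      (h.measurable_postSD.comp hD)))
  refine (h.lintegral_data_query hsel n hΨ).trans
    (lintegral_congr fun ω => lintegral_congr fun u => ?_)
  simp only
  congr 2
  rw [query, add_sub_cancel_left, mul_div_cancel_left₀ _ (h.postSD_pos _ _).ne']

lemma map_innovation (h : IsNoisyGP P f k ε σ) (hsel : ∀ n, Measurable (sel n)) (n : ℕ) :
    P.map (innovation k σ sel f ε n) = gaussianReal 0 1 := by
  have hd := h.measurable_data hsel n
  have hi := h.measurable_innovation hsel n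
  have := Measure.isProbabilityMeasure_map (μ := P) hd.aemeasurable
  have h1 := congrArg (Measure.map Prod.snd) (h.map_data_innovation hsel n)
  rw [Measure.map_map measurable_snd (hd.prodMk hi), Measure.map_snd_prod, measure_univ,
    one_smul] at h1
  exact h1

lemma indepFun_data_innovation (h : IsNoisyGP P f k ε σ) (hsel : ∀ n, Measurable (sel n)) (n : ℕ) :
    IndepFun (data sel f ε n) (innovation k σ sel f ε n) P := by
  rw [indepFun_iff_map_prod_eq_prod_map_map (h.measurable_data hsel n).aemeasurable
    (h.measurable_innovation hsel n).aemeasurable, h.map_innovation hsel,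
    h.map_data_innovation hsel]

lemma integrable_innovation (h : IsNoisyGP P f k ε σ) (hsel : ∀ n, Measurable (sel n)) (n : ℕ) :
    Integrable (innovation k σ sel f ε n) P := by
  have h1 : Integrable (id : ℝ → ℝ) (P.map (innovation k σ sel f ε n)) := by
    rw [h.map_innovation hsel]
    exact (memLp_id_gaussianReal 1).integrable le_rfl
  exact h1.comp_measurable (h.measurable_innovation hsel n)

lemma integral_innovation (h : IsNoisyGP P f k ε σ) (hsel : ∀ n, Measurable (sel n)) (n : ℕ) :
    ∫ ω, innovation k σ sel f ε n ω ∂P = 0 := by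
  have := integral_map (μ := P) (h.measurable_innovation hsel n).aemeasurable
    (f := fun x : ℝ => x) measurable_id.aestronglyMeasurable
  rw [← this, h.map_innovation hsel, integral_id_gaussianReal]

lemma integrable_postSD_mul_innovation (h : IsNoisyGP P f k ε σ) (hsel : ∀ n, Measurable (sel n))
    (n : ℕ) : Integrable (fun ω => postSD k σ (data sel f ε n ω) (query sel f ε n ω)
      * innovation k σ sel f ε n ω) P := by
  refine (h.integrable_innovation hsel n).bdd_mul (c := 1)
    (h.measurable_postSD.comp (h.measurable_data_query hsel n)).aestronglyMeasurable
    (Eventually.of_forall fun ω => ?_)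
  rw [Real.norm_of_nonneg (h.postSD_pos _ _).le]
  exact h.postSD_le_one _ _

/-- The values at the query points are integrable, by induction on the round: the posterior mean is
a combination with bounded coefficients of the earlier observations. -/
lemma integrable_eval_query (h : IsNoisyGP P f k ε σ) (hsel : ∀ n, Measurable (sel n)) (n : ℕ) :
    Integrable (fun ω => postMean k σ (data sel f ε n ω) (query sel f ε n ω)) P ∧
      Integrable (fun ω => f (query sel f ε n ω) ω) P := by
  induction n using Nat.strong_induction_on with
  | _ n ih =>
  have h1 : Integrable (fun ω => postMean k σ (data sel f ε n ω) (query sel f ε n ω)) P := by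
    have h2 : Integrable (fun ω => ∑ i : Fin n,
        σ⁻¹ * ‖f (query sel f ε i ω) ω + ε i ω‖) P :=
      integrable_finsetSum _ fun i _ => (((ih i i.isLt).2.add
        ((h.memLp_two_noise i).integrable one_le_two)).norm).const_mul _
    refine h2.mono' (h.measurable_postMean.comp
      (h.measurable_data_query hsel n)).aestronglyMeasurable (Eventually.of_forall fun ω => ?_)
    rw [h.isPSDKernel.postMean_eq]
    refine (norm_sum_le _ _).trans (Finset.sum_le_sum fun i _ => ?_)
    rw [norm_mul, Real.norm_eq_abs]
    simp only [data_apply sel f ε n ω i]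
    gcongr
    exact h.isPSDKernel.abs_coeffs_le h.sigma_pos (data sel f ε n ω) (h.kernel_le _ _) i
  refine ⟨h1, ?_⟩
  have h2 := h1.add (h.integrable_postSD_mul_innovation hsel n)
  exact h2.congr (Eventually.of_forall fun ω => (h.eval_query_eq n ω).symm)

/-- The posterior mean at the query point is the conditional expectation of the value there. -/
lemma condExp_eval_query (h : IsNoisyGP P f k ε σ) (hsel : ∀ n, Measurable (sel n)) (n : ℕ) :
    P[fun ω => f (query sel f ε n ω) ω | dataSigma sel f ε n]
      =ᵐ[P] fun ω => postMean k σ (data sel f ε n ω) (query sel f ε n ω) := by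
  have hm : dataSigma sel f ε n ≤ (inferInstance : MeasurableSpace Ω) :=
    (h.measurable_data hsel n).comap_le
  have hdq : Measurable[dataSigma sel f ε n] fun ω => (data sel f ε n ω, query sel f ε n ω) := by
    have : Measurable[dataSigma sel f ε n] (data sel f ε n) := comap_measurable _
    exact this.prodMk ((hsel n).comp this)
  set μ := fun ω => postMean k σ (data sel f ε n ω) (query sel f ε n ω) with hμ
  set s := fun ω => postSD k σ (data sel f ε n ω) (query sel f ε n ω) with hs
  set Z := innovation k σ sel f ε n with hZ
  have hμm : StronglyMeasurable[dataSigma sel f ε n] μ :=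
    (h.measurable_postMean.comp hdq).stronglyMeasurable
  have hsm : StronglyMeasurable[dataSigma sel f ε n] s :=
    (h.measurable_postSD.comp hdq).stronglyMeasurable
  have e1 : (fun ω => f (query sel f ε n ω) ω) = μ + s * Z :=
    funext fun ω => h.eval_query_eq n ω
  have hμi : Integrable μ P := (h.integrable_eval_query hsel n).1
  have hsZ : Integrable (s * Z) P := h.integrable_postSD_mul_innovation hsel n
  have hZc : P[Z | dataSigma sel f ε n] =ᵐ[P] fun _ => 0 := by
    have hZm := h.measurable_innovation hsel n
    have h1 := condExp_indep_eq (μ := P) (m₁ := MeasurableSpace.comap Z inferInstance)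
      (m₂ := dataSigma sel f ε n) (f := Z) hZm.comap_le hm
      (comap_measurable Z).stronglyMeasurable
      ((IndepFun_iff_Indep _ _ _).1 (h.indepFun_data_innovation hsel n).symm)
    rwa [h.integral_innovation hsel n] at h1
  rw [e1]
  filter_upwards [condExp_add hμi hsZ (dataSigma sel f ε n),
    condExp_mul_of_stronglyMeasurable_left hsm hsZ (h.integrable_innovation hsel n), hZc]
    with ω h1 h2 h3
  rw [h1, Pi.add_apply, condExp_of_stronglyMeasurable hm hμm hμi, h2, Pi.mul_apply, h3]
  simp

end IsNoisyGP

/-! ### The regret bounds -/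

lemma regret_nonneg {Ω X : Type*} {f : X → Ω → ℝ} (sel : (n : ℕ) → (Fin n → X × ℝ) → X)
    (ε : ℕ → Ω → ℝ) (n : ℕ) {ω : Ω} (hω : BddAbove (Set.range fun x => f x ω)) :
    0 ≤ regret sel f ε n ω :=
  sub_nonneg.2 (le_ciSup hω (query sel f ε n ω))

lemma nu_le_nuStar {Ω X : Type*} (k : X → X → ℝ) (σ : ℝ)
    (mhat : (n : ℕ) → (Fin n → X × ℝ) → ℝ) (sel : (n : ℕ) → (Fin n → X × ℝ) → X) (f : X → Ω → ℝ)
    (ε : ℕ → Ω → ℝ) {n T : ℕ} (hn : n < T) (ω : Ω) :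
    nu k σ mhat n (data sel f ε n ω) ≤ nuStar k σ mhat sel f ε T ω :=
  le_ciSup (f := fun n : Fin T => nu k σ mhat n (data sel f ε n ω))
    (Set.finite_range _).bddAbove ⟨n, hn⟩

namespace IsNoisyGP

variable {Ω X : Type*} [MeasurableSpace Ω] [MeasurableSpace X] {P : Measure Ω}
  [IsProbabilityMeasure P] {f : X → Ω → ℝ} {k : X → X → ℝ} {ε : ℕ → Ω → ℝ} {σ : ℝ} {n T : ℕ}
  {sel : (n : ℕ) → (Fin n → X × ℝ) → X} {mhat : (n : ℕ) → (Fin n → X × ℝ) → ℝ}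

/-- The posterior variances at the query points sum to at most a constant times the maximum
information gain. -/
lemma sum_postSD_sq_le (h : IsNoisyGP P f k ε σ) (sel : (n : ℕ) → (Fin n → X × ℝ) → X) (T : ℕ)
    (ω : Ω) : ∑ n ∈ Finset.range T, postSD k σ (data sel f ε n ω) (query sel f ε n ω) ^ 2
      ≤ constC σ * maxInfoGain k σ T := by
  set b : ℕ → X := fun n => query sel f ε n ω with hb
  have h1 : infoGain k σ (fun i : Fin T => b i) ≤ maxInfoGain k σ T :=
    le_ciSup (h.isPSDKernel.bddAbove_infoGain h.sigma_pos h.kernel_pos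
      (fun x => h.kernel_le x x) T) fun i : Fin T => b i
  refine le_trans ?_ (mul_le_mul_of_nonneg_left h1 (constC_nonneg σ))
  rw [h.isPSDKernel.infoGain_eq_sum h.sigma_pos h.kernel_pos, Finset.mul_sum]
  refine Finset.sum_le_sum fun n _ => ?_
  have h2 : postCov k σ (data sel f ε n ω) (b n) (b n)
      = postCov k σ (fun i : Fin n => (b i, (0 : ℝ))) (b n) (b n) :=
    postCov_congr _ _ (fun i => by rw [data_apply]) _ _
  rw [h.postSD_sq, h2]
  exact le_constC_mul_log h.sigma_pos
    (h.isPSDKernel.postCov_pos h.sigma_pos _ (h.kernel_pos _)).le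
    ((h.isPSDKernel.postCov_le h.sigma_pos _ _).trans (h.kernel_le _ _))

/-- Sums of nonnegative regrets of at most `nu + z` posterior standard deviations in each round. The
Cauchy-Schwarz inequality may be multiplied by `nuStar + z` because this is nonnegative, as the
regret of the first round is. -/
lemma sum_le_of_forall_le (h : IsNoisyGP P f k ε σ) (hT : 1 ≤ T) {ω : Ω} {r : ℕ → ℝ} {z : ℝ}
    (hr0 : ∀ n < T, 0 ≤ r n)
    (hr : ∀ n < T, r n ≤ (nu k σ mhat n (data sel f ε n ω) + z)
      * postSD k σ (data sel f ε n ω) (query sel f ε n ω)) :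
    ∑ n ∈ Finset.range T, r n ≤ (nuStar k σ mhat sel f ε T ω + z)
      * Real.sqrt (constC σ * T * maxInfoGain k σ T) := by
  set s : ℕ → ℝ := fun n => postSD k σ (data sel f ε n ω) (query sel f ε n ω) with hs
  have hspos : ∀ n, 0 < s n := fun n => h.postSD_pos _ _
  have hle : ∀ n < T, r n ≤ (nuStar k σ mhat sel f ε T ω + z) * s n := fun n hn =>
    (hr n hn).trans (mul_le_mul_of_nonneg_right
      (by linarith [nu_le_nuStar k σ mhat sel f ε hn ω]) (hspos n).le)
  have hν : 0 ≤ nuStar k σ mhat sel f ε T ω + z :=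
    nonneg_of_mul_nonneg_left ((hr0 0 hT).trans (hle 0 hT)) (hspos 0)
  calc ∑ n ∈ Finset.range T, r n
      ≤ ∑ n ∈ Finset.range T, (nuStar k σ mhat sel f ε T ω + z) * s n :=
        Finset.sum_le_sum fun n hn => hle n (Finset.mem_range.1 hn)
    _ = (nuStar k σ mhat sel f ε T ω + z) * ∑ n ∈ Finset.range T, s n := by
        rw [Finset.mul_sum]
    _ ≤ _ := by
        refine mul_le_mul_of_nonneg_left (Real.le_sqrt_of_sq_le ?_) hν
        have h1 := sq_sum_le_card_mul_sum_sq (s := Finset.range T) (f := s)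
        rw [Finset.card_range] at h1
        refine h1.trans ?_
        have h2 := mul_le_mul_of_nonneg_left (h.sum_postSD_sq_le sel T ω)
          (Nat.cast_nonneg (α := ℝ) T)
        linarith

/-- On its choice, the strategy attains the smallest standardized gap. -/
lemma nu_mul_postSD (h : IsNoisyGP P f k ε σ) {ω : Ω}
    (hEST : IsESTChoice (mhat n (data sel f ε n ω)) (postMean k σ (data sel f ε n ω))
      (postSD k σ (data sel f ε n ω)) (query sel f ε n ω)) :
    nu k σ mhat n (data sel f ε n ω) * postSD k σ (data sel f ε n ω) (query sel f ε n ω)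
      = mhat n (data sel f ε n ω) - postMean k σ (data sel f ε n ω) (query sel f ε n ω) := by
  rw [nu_eq hEST, div_mul_cancel₀ _ (h.postSD_pos _ _).ne']

/-- The bound on the cumulative expected regret. No nonnegativity of the gaps is needed as a
hypothesis: it follows from that of the conditional expectation of the regret. -/
lemma ae_sum_condExp_regret_le (h : IsNoisyGP P f k ε σ)
    (hf_bdd : ∀ᵐ ω ∂P, BddAbove (Set.range fun x => f x ω)) (hf_int : Integrable (fmax f) P)
    (hT : 1 ≤ T) (hsel : ∀ n, Measurable (sel n))
    (hEST : ∀ n < T, ∀ᵐ ω ∂P,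
      IsESTChoice (mhat n (data sel f ε n ω)) (postMean k σ (data sel f ε n ω))
        (postSD k σ (data sel f ε n ω)) (query sel f ε n ω)) :
    ∀ᵐ ω ∂P,
      (∀ n < T, (P[fmax f | dataSigma sel f ε n]) ω ≤ mhat n (data sel f ε n ω)) →
      ∑ n ∈ Finset.range T, (P[regret sel f ε n | dataSigma sel f ε n]) ω
        ≤ nuStar k σ mhat sel f ε T ω * Real.sqrt (constC σ * T * maxInfoGain k σ T) := by
  have hr0 : ∀ n, ∀ᵐ ω ∂P, 0 ≤ (P[regret sel f ε n | dataSigma sel f ε n]) ω := fun n =>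
    condExp_nonneg (hf_bdd.mono fun ω hω => regret_nonneg sel ε n hω)
  have hr : ∀ n, ∀ᵐ ω ∂P, (P[regret sel f ε n | dataSigma sel f ε n]) ω
      = (P[fmax f | dataSigma sel f ε n]) ω
        - postMean k σ (data sel f ε n ω) (query sel f ε n ω) := fun n => by
    filter_upwards [condExp_sub hf_int (h.integrable_eval_query hsel n).2 (dataSigma sel f ε n),
      h.condExp_eval_query hsel n] with ω h1 h2
    rw [← h2]
    exact h1
  have hE : ∀ n, ∀ᵐ ω ∂P, n < T → IsESTChoice (mhat n (data sel f ε n ω))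
      (postMean k σ (data sel f ε n ω)) (postSD k σ (data sel f ε n ω)) (query sel f ε n ω) :=
    fun n => eventually_imp_distrib_left.2 (hEST n)
  filter_upwards [ae_all_iff.2 hr0, ae_all_iff.2 hr, ae_all_iff.2 hE] with ω h0 h1 h2 hm
  have := h.sum_le_of_forall_le (mhat := mhat) (sel := sel) hT (ω := ω) (z := 0)
    (r := fun n => (P[regret sel f ε n | dataSigma sel f ε n]) ω) (fun n _ => h0 n) fun n hn => by
      rw [add_zero, h.nu_mul_postSD (h2 n hn), h1 n]
      exact sub_le_sub_right (hm n hn) _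
  rwa [add_zero] at this

lemma measure_innovation_lt (h : IsNoisyGP P f k ε σ) (hsel : ∀ n, Measurable (sel n)) (n : ℕ)
    (z : ℝ) : P {ω | innovation k σ sel f ε n ω < z} = gaussianReal 0 1 (Set.Iio z) := by
  rw [← h.map_innovation hsel n, Measure.map_apply (h.measurable_innovation hsel n)
    measurableSet_Iio]
  rfl

/-- The bound on the cumulative regret fails, while the estimates bound the maximum, only if in some
round the value at the query point is more than `zeta` posterior standard deviations below the
posterior mean. -/
lemma measure_sum_regret_gt_le (h : IsNoisyGP P f k ε σ)
    (hf_bdd : ∀ᵐ ω ∂P, BddAbove (Set.range fun x => f x ω))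
    (hT : 1 ≤ T) (hsel : ∀ n, Measurable (sel n))
    (hEST : ∀ n < T, ∀ᵐ ω ∂P,
      IsESTChoice (mhat n (data sel f ε n ω)) (postMean k σ (data sel f ε n ω))
        (postSD k σ (data sel f ε n ω)) (query sel f ε n ω)) {δ : ℝ} (hδ : 0 < δ) :
    P {ω | (∀ n < T, fmax f ω ≤ mhat n (data sel f ε n ω)) ∧
        ¬ ∑ n ∈ Finset.range T, regret sel f ε n ω
          ≤ (nuStar k σ mhat sel f ε T ω + zeta T δ)
            * Real.sqrt (constC σ * T * maxInfoGain k σ T)}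
      ≤ ENNReal.ofReal δ := by
  set bad : ℕ → Set Ω := fun n => {ω | innovation k σ sel f ε n ω < -zeta T δ} with hbad
  have hsub : ∀ᵐ ω ∂P, (ω ∈ {ω | (∀ n < T, fmax f ω ≤ mhat n (data sel f ε n ω)) ∧
        ¬ ∑ n ∈ Finset.range T, regret sel f ε n ω
          ≤ (nuStar k σ mhat sel f ε T ω + zeta T δ)
            * Real.sqrt (constC σ * T * maxInfoGain k σ T)}) →
      ω ∈ ⋃ n ∈ Finset.range T, bad n := by
    have hE : ∀ᵐ ω ∂P, ∀ n, n < T → IsESTChoice (mhat n (data sel f ε n ω))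
        (postMean k σ (data sel f ε n ω)) (postSD k σ (data sel f ε n ω))
        (query sel f ε n ω) :=
      ae_all_iff.2 fun n => eventually_imp_distrib_left.2 (hEST n)
    filter_upwards [hE, hf_bdd] with ω h1 h2
    rintro ⟨hm, hgt⟩
    by_contra hgood
    simp only [hbad, Set.mem_iUnion, Finset.mem_range, Set.mem_ofPred_eq, not_exists,
      not_lt] at hgood
    refine hgt (h.sum_le_of_forall_le hT (fun n _ => regret_nonneg sel ε n h2) fun n hn => ?_)
    have h3 := mul_le_mul_of_nonneg_left (hgood n hn)
      (h.postSD_pos (data sel f ε n ω) (query sel f ε n ω)).le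
    have h4 := h.eval_query_eq (sel := sel) n ω
    rw [add_mul, h.nu_mul_postSD (h1 n hn), regret]
    linarith [hm n hn]
  calc _ ≤ P (⋃ n ∈ Finset.range T, bad n) := measure_mono_ae hsub
    _ ≤ ∑ n ∈ Finset.range T, P (bad n) := measure_biUnion_finset_le _ _
    _ ≤ ∑ n ∈ Finset.range T, ENNReal.ofReal (δ / T) := by
        refine Finset.sum_le_sum fun n _ => ?_
        rw [hbad, h.measure_innovation_lt hsel]
        exact gaussianReal_Iio_neg_zeta_le hT hδ
    _ = ENNReal.ofReal δ := by
        have hT' : (T : ℝ) ≠ 0 := by exact_mod_cast (by omega : T ≠ 0)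
        rw [Finset.sum_const, Finset.card_range, nsmul_eq_mul, ← ENNReal.ofReal_natCast,
          ← ENNReal.ofReal_mul (Nat.cast_nonneg T), mul_div_cancel₀ _ hT']

end IsNoisyGP

end GPOpt

theorem theorem1 {Ω X : Type*} [MeasurableSpace Ω] [MeasurableSpace X]
    (P : Measure Ω) [IsProbabilityMeasure P]
    -- the unknown function is a centered Gaussian process with a kernel bounded by one
    (k : X → X → ℝ) (f : X → Ω → ℝ)
    (hk_pos : ∀ x, 0 < k x x) (hk_le : ∀ x x', k x x' ≤ 1)
    (hf_meas : ∀ x, Measurable (f x))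
    (hf_joint : Measurable[MeasurableSpace.prod inferInstance (GPOpt.funSigma f)]
      (fun p : X × Ω => f p.1 p.2))
    (hf : GPOpt.IsCenteredGP f k P)
    (hf_bdd : ∀ᵐ ω ∂P, BddAbove (Set.range fun x => f x ω))
    (hf_int : Integrable (GPOpt.fmax f) P)
    -- the observation noise
    (ε : ℕ → Ω → ℝ) (σ : ℝ) (hσ : 0 < σ) (hε : GPOpt.IsGaussianNoise ε σ P)
    (hfε : IndepFun (fun ω x => f x ω) (fun ω n => ε n ω) P)
    -- the estimates of the maximum, and the query points chosen by the strategy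
    (T : ℕ) (hT : 1 ≤ T)
    (mhat : (n : ℕ) → (Fin n → X × ℝ) → ℝ)
    (sel : (n : ℕ) → (Fin n → X × ℝ) → X) (hsel : ∀ n, Measurable (sel n))
    (hEST : ∀ n < T, ∀ᵐ ω ∂P,
      GPOpt.IsESTChoice (mhat n (GPOpt.data sel f ε n ω))
        (GPOpt.postMean k σ (GPOpt.data sel f ε n ω))
        (GPOpt.postSD k σ (GPOpt.data sel f ε n ω))
        (GPOpt.query sel f ε n ω)) :
    -- cumulative expected regret, wherever the estimates bound the conditional expectation of
    -- the maximum (in particular if they bound the maximum almost surely)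
    (∀ᵐ ω ∂P,
      (∀ n < T, (P[GPOpt.fmax f | GPOpt.dataSigma sel f ε n]) ω
        ≤ mhat n (GPOpt.data sel f ε n ω)) →
      ∑ n ∈ Finset.range T, (P[GPOpt.regret sel f ε n | GPOpt.dataSigma sel f ε n]) ω
        ≤ GPOpt.nuStar k σ mhat sel f ε T ω
          * Real.sqrt (GPOpt.constC σ * T * GPOpt.maxInfoGain k σ T)) ∧
    -- cumulative regret: the event that the estimates bound the maximum and yet the regret bound
    -- fails has probability at most `δ`
    (∀ δ : ℝ, 0 < δ → δ < 1 →
      P {ω | (∀ n < T, GPOpt.fmax f ω ≤ mhat n (GPOpt.data sel f ε n ω)) ∧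
        ¬ ∑ n ∈ Finset.range T, GPOpt.regret sel f ε n ω
          ≤ (GPOpt.nuStar k σ mhat sel f ε T ω + GPOpt.zeta T δ)
            * Real.sqrt (GPOpt.constC σ * T * GPOpt.maxInfoGain k σ T)}
        ≤ ENNReal.ofReal δ) := by
  have h : GPOpt.IsNoisyGP P f k ε σ :=
    ⟨hk_pos, hk_le, hf_meas, hf_joint, hf, hσ, hε, hfε⟩
  exact ⟨h.ae_sum_condExp_regret_le hf_bdd hf_int hT hsel hEST,
    fun δ hδ _ => h.measure_sum_regret_gt_le hf_bdd hT hsel hEST hδ⟩
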